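/- A tropical curve $\Gamma$ is a finite connected metric graph together with a model $G=(V,E)$, positive edge lengths $l(e)$, $e\in E$, and vertex weights $h:V\to\mathbb{Z}_{\ge 0}$ (loops and multiple edges allowed). Its genus is $b_1(G)+\sum_v h(v)$, and it is stable if $2h(v)-2+|v|>0$ for every vertex $v$, where $|v|$ is the valence; in that case $G$ is the minimal model of $\Gamma$. A rational function on $\Gamma$ is a continuous real function that is piecewise affine with integer slopes on every edge; $(f)$ is the divisor whose coefficient at $p$ is the sum of the outgoing slopes of $f$ at $p$. The canonical divisor is $K_\Gamma=\sum_{v\in V}(2h(v)+|v|-2)\,v$, and $|K_\Gamma|$ is the set of effective divisors $D'=K_\Gamma+(f)$ with $f$ rational. Orient the edges of $G$. The space $|K_\Gamma|$ is a polyhedral complex whose (relatively open) cells consist of the divisors $D'=K_\Gamma+(f)$ with prescribed discrete data: the coefficient of $D'$ at every vertex, the slope of $f$ at the starting point of every edge, and for every edge the ordered list of the coefficients of $D'$ at the successive points of its support in the interior of the edge. The positions of these points are affine coordinates on the cell. **Proposition.** Let $\Gamma$ be a stable tropical curve of genus $2$ with minimal model $G$. Then the combinatorial structure of $|K_\Gamma|$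 is determined by $G$ and is independent of the edge lengths: if $\Gamma_1,\Gamma_2$ are two tropical curves with the same minimal model $G$, stable of genus $2$, then the same discrete data define non-empty cells in $|K_{\Gamma_1}|$ and in $|K_{\Gamma_2}|$, corresponding cells have the same dimension, and one cell is a face of another in $|K_{\Gamma_1}|$ if and only if this holds for the corresponding cells in $|K_{\Gamma_2}|$. Moreover, if $G$ is the theta graph (two vertices of weight $0$ joined by three edges), then for all edge lengths $|K_\Gamma|$ is a one-dimensional complex consisting of three segments: it has exactly four vertices and three one-dimensional cells and no cells of higher dimension, every one-dimensional cell has exactly two end vertices, and any two distinct segments have exactly one vertex in common, namely the divisor $K_\Gamma$. -/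

import Mathlib

open Set Topology
open scoped BigOperators

noncomputable section

/-- A finite vertex-weighted multigraph with vertex set `V` and edge set `E`; loops and multiple
edges are allowed. Every edge carries an auxiliary orientation from `src e` to `tgt e`. -/
structure WeightedGraph (V E : Type*) where
  src : E → V
  tgt : E → V
  /-- the genus function `h` -/
  weight : V → ℕ

namespace WeightedGraph

variable {V E : Type*} (G : WeightedGraph V E)

/-- The set of connected components. -/
def Components : Type _ := Quot (fun u v : V => ∃ e : E, G.src e = u ∧ G.tgt e = v)

def Connected : Prop := Nat.card G.Components = 1

/-- The valence of `v`: the number of half-edges at `v`, so that a loop counts twice. -/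
def valence (v : V) : ℕ := Nat.card {e : E // G.src e = v} + Nat.card {e : E // G.tgt e = v}

/-- The first Betti number `|E| - |V| + #components`. -/
def betti : ℤ := (Nat.card E : ℤ) - Nat.card V + Nat.card G.Components

/-- The genus `b₁(G) + ∑ h(v)`. -/
def genus [Fintype V] : ℤ := G.betti + ∑ v, (G.weight v : ℤ)

/-- Stability: `2 h(v) - 2 + |v| > 0` for every vertex. -/
def Stable : Prop := ∀ v, 0 < 2 * (G.weight v : ℤ) - 2 + G.valence v

/-- The theta graph: two vertices of weight zero joined by three edges. -/
def IsTheta : Prop :=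
  Nat.card V = 2 ∧ Nat.card E = 3 ∧ (∀ v, G.weight v = 0) ∧ ∀ e, G.src e ≠ G.tgt e

end WeightedGraph

/-- A tropical curve with model `G`: a positive length for every edge of `G`. If `G` is stable
then `G` is the minimal model of the curve. -/
structure TropicalCurve {V E : Type*} (G : WeightedGraph V E) where
  length : E → ℝ
  length_pos : ∀ e, 0 < length e

/-- The discrete data describing a cell of a linear system: the multiplicity of the divisor at
every vertex, the slope of the rational function at the starting point of every edge, and for
every edge the multiplicities of the divisor at the points of its support in the interior of the
edge, in the order in which these points occur on the edge. -/
@[ext] structure CellData (V E : Type*) where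
  vertexMult : V → ℤ
  slope : E → ℤ
  mults : E → List ℤ

namespace TropicalCurve

variable {V E : Type*} {G : WeightedGraph V E} (Γ : TropicalCurve G)

/-- The points of the metric graph: the vertices and the interior points of the edges; an interior
point of `e` is given by its distance `x ∈ (0, l(e))` from the starting point of `e`. -/
inductive Point : Type _
  | vertex (v : V) : Point
  | interior (e : E) (x : ℝ) (hx : 0 < x ∧ x < Γ.length e) : Point

open Classical in
/-- The parametrization `[0, l(e)] → Γ` of the edge `e` (extended to `ℝ` by constants). -/
def par (e : E) (x : ℝ) : Γ.Point :=
  if h : 0 < x ∧ x < Γ.length e then .interior e x h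
  else if x ≤ 0 then .vertex (G.src e) else .vertex (G.tgt e)

/-- The topology of the metric graph: the intervals `[0, l(e)]` are glued along their endpoints,
that is, a set is open if and only if its preimage in every `[0, l(e)]` is open. -/
instance : TopologicalSpace Γ.Point :=
  ⨆ e, TopologicalSpace.coinduced (fun x : Icc (0 : ℝ) (Γ.length e) => Γ.par e x) inferInstance

/-- A function on `Γ` restricted to the edge `e`, in the coordinate of `e`. -/
def onEdge (f : Γ.Point → ℝ) (e : E) : ℝ → ℝ := fun x => f (Γ.par e x)

/-- Rational functions: continuous functions that are piecewise affine with integer slopes on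
every edge, with finitely many break points. -/
def IsRational (f : Γ.Point → ℝ) : Prop :=
  Continuous f ∧ ∀ e, ∃ S : Finset ℝ, ∀ a b : ℝ, 0 ≤ a → a < b → b ≤ Γ.length e →
    (∀ s ∈ S, s ∉ Ioo a b) → ∃ (m : ℤ) (c : ℝ), ∀ x ∈ Icc a b, Γ.onEdge f e x = m * x + c

/-- The slope of `f` on `e` to the right of `x`, in the direction of the orientation of `e`. -/
def slopeRight (f : Γ.Point → ℝ) (e : E) (x : ℝ) : ℝ := derivWithin (Γ.onEdge f e) (Ioi x) x

/-- The slope of `f` on `e` to the left of `x`, in the direction of the orientation of `e`. -/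
def slopeLeft (f : Γ.Point → ℝ) (e : E) (x : ℝ) : ℝ := derivWithin (Γ.onEdge f e) (Iio x) x

/-- The order of `f` at a point: the sum of the outgoing slopes. -/
def ord [Fintype E] [DecidableEq V] (f : Γ.Point → ℝ) : Γ.Point → ℝ
  | .vertex v => (∑ e, if G.src e = v then Γ.slopeRight f e 0 else 0)
      + ∑ e, if G.tgt e = v then -Γ.slopeLeft f e (Γ.length e) else 0
  | .interior e x _ => Γ.slopeRight f e x + -Γ.slopeLeft f e x

/-- Divisors: the free abelian group on the points of `Γ`. -/
abbrev Divisor : Type _ := Γ.Point →₀ ℤ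

/-- The canonical divisor `∑ (2 h(v) + |v| - 2) (v)`. -/
def canonical [Fintype V] : Γ.Divisor :=
  ∑ v, Finsupp.single (.vertex v) (2 * (G.weight v : ℤ) + G.valence v - 2)

/-- The relation `D' = D + (f)`. -/
def IsAddDiv [Fintype E] [DecidableEq V] (D : Γ.Divisor) (f : Γ.Point → ℝ) (D' : Γ.Divisor) :
    Prop :=
  ∀ p, (D' p : ℝ) = D p + Γ.ord f p

/-- The linear system `|D|`: the effective divisors equivalent to `D`. -/
def linearSystem [Fintype E] [DecidableEq V] (D : Γ.Divisor) : Set Γ.Divisor :=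
  {D' | 0 ≤ D' ∧ ∃ f, Γ.IsRational f ∧ Γ.IsAddDiv D f D'}

/-- The topology on the effective divisors of degree `n` is the quotient topology from `Γⁿ` along
`(p₁, …, pₙ) ↦ p₁ + ⋯ + pₙ`; the different degrees are put side by side. -/
@[reducible] def divisorTopology : TopologicalSpace Γ.Divisor :=
  ⨆ n : ℕ, TopologicalSpace.coinduced
    (fun p : Fin n → Γ.Point => ∑ i, Finsupp.single (p i) (1 : ℤ)) inferInstance

theorem par_of_mem {e : E} {x : ℝ} (h : 0 < x ∧ x < Γ.length e) :
    Γ.par e x = .interior e x h := dif_pos h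

theorem finite_positions (D : Γ.Divisor) (e : E) :
    {x : ℝ | (0 < x ∧ x < Γ.length e) ∧ D (Γ.par e x) ≠ 0}.Finite := by
  refine Set.Finite.of_finite_image (f := Γ.par e)
    (D.support.finite_toSet.subset ?_) ?_
  · rintro _ ⟨x, hx, rfl⟩
    simpa using hx.2
  · intro x hx y hy h
    rw [Γ.par_of_mem hx.1, Γ.par_of_mem hy.1] at h
    simpa using h

/-- The coordinates `x₁ < ⋯ < x_r` of the points of the support of `D` in the interior of `e`. -/
def positions (D : Γ.Divisor) (e : E) : List ℝ := (Γ.finite_positions D e).toFinset.sort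

/-- The open cell of `|D|` with given discrete data (`D` being supported on the vertices): all
`D' = D + (f) ≥ 0` in `|D|` with these data. -/
def cell [Fintype E] [DecidableEq V] (D : Γ.Divisor) (c : CellData V E) : Set Γ.Divisor :=
  {D' | 0 ≤ D' ∧ ∃ f, Γ.IsRational f ∧ Γ.IsAddDiv D f D' ∧
    (∀ v, D' (.vertex v) = c.vertexMult v) ∧
    (∀ e, Γ.slopeRight f e 0 = c.slope e) ∧
    (∀ e, (Γ.positions D' e).map (fun x => D' (Γ.par e x)) = c.mults e)}

/-- The cells of the polyhedral complex `|D|`: the discrete data whose open cell is not empty. -/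
def cells [Fintype E] [DecidableEq V] (D : Γ.Divisor) : Set (CellData V E) :=
  {c | (Γ.cell D c).Nonempty}

/-- `c` is a face of `c'` (possibly `c'` itself): the cell of `c` lies in the closure of the cell
of `c'`. -/
def IsFace [Fintype E] [DecidableEq V] (D : Γ.Divisor) (c c' : CellData V E) : Prop :=
  Γ.cell D c ⊆ closure[Γ.divisorTopology] (Γ.cell D c')

/-- The affine coordinates on the cell of `c`: the positions `x_{e,j}` of the points on the
edges. -/
def coords (c : CellData V E) (D' : Γ.Divisor) : (Σ e : E, Fin (c.mults e).length) → ℝ :=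
  fun q => (Γ.positions D' q.1).getD q.2 0

/-- The dimension of a cell: the dimension of its affine hull in the coordinates `x_{e,j}`. -/
def cellDim [Fintype E] [DecidableEq V] (D : Γ.Divisor) (c : CellData V E) : ℕ :=
  Module.finrank ℝ (vectorSpan ℝ (Γ.coords c '' Γ.cell D c))

/-- The linear systems of `D₁` on `Γ₁` and of `D₂` on `Γ₂`, two tropical curves with the same
minimal model, have the same combinatorial structure: they have the same cells, and these have the
same dimensions and the same faces. -/
def SameCombinatorialStructure [Fintype E] [DecidableEq V] {Γ₁ Γ₂ : TropicalCurve G}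
    (D₁ : Γ₁.Divisor) (D₂ : Γ₂.Divisor) : Prop :=
  Γ₁.cells D₁ = Γ₂.cells D₂ ∧
  (∀ c ∈ Γ₁.cells D₁, Γ₁.cellDim D₁ c = Γ₂.cellDim D₂ c) ∧
  ∀ c ∈ Γ₁.cells D₁, ∀ c' ∈ Γ₁.cells D₁, Γ₁.IsFace D₁ c c' ↔ Γ₂.IsFace D₂ c c'

/-- The set of `i`-dimensional cells of `|D|`. -/
def cellsOfDim [Fintype E] [DecidableEq V] (D : Γ.Divisor) (i : ℕ) : Set (CellData V E) :=
  {c ∈ Γ.cells D | Γ.cellDim D c = i}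

/-- The set of vertices (zero-dimensional faces) of the closure of the cell of `c`. -/
def verticesOf [Fintype E] [DecidableEq V] (D : Γ.Divisor) (c : CellData V E) :
    Set (CellData V E) :=
  {v ∈ Γ.cellsOfDim D 0 | Γ.IsFace D v c}

end TropicalCurve

end

/-!
The argument rests on the convexity of `f` on every edge when `K + (f)` is effective: the canonical
divisor has no interior points of edges in its support (`IsAddDiv.convexOn`, deduced from local
supporting lines in `convexOn_Icc_of_eventually_support`).

*Independence of the edge lengths.* In genus two all coefficients of `K` are positive with sum two,
so there are at most two vertices, and if there are two then both have coefficient one. At a vertex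
where `f` is maximal, every edge to a strictly lower vertex has outgoing slope at most `-1`, whereas
the coefficient of `K` allows only one such edge. Hence `f` takes different values at the ends of at
most one edge (`IsAddDiv.edge_unique`). Stretching every edge linearly is a homeomorphism
`rescale Γ₁ Γ₂`, and a function on `Γ₁` can be carried over with the same slopes if its differences
along the edges, multiplied by the stretching factors, are again differences of a function on the
vertices. As only one edge matters, multiplying the values at the vertices by the stretching factor
of this edge does it (`rescaleFun`). So the homeomorphism of the spaces of divisors maps each cell
onto the cell with the same data (`cell_eq_image`); it respects closures, and it acts on the
coordinates of a cell by an invertible diagonal matrix.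

*Theta graphs.* There are three edges between the two vertices, so `f` has the same value at both
vertices. Its outgoing slopes there are nonpositive, with sum at least `-1`, so `f` is constant on
all edges but one, where it is the tent function with slopes `-1`, `0`, `1`
(`IsAddDiv.exists_isTent`). The elements of the canonical system are therefore the divisors
`pairDiv e t` consisting of the two points at distance `t ≤ l(e) / 2` from the ends of an edge `e`
(`mem_cell_iff`): for every edge a segment from `K` (at `t = 0`) to twice the midpoint of the edge.
That a segment has no further vertex in its closure is seen from the openness of the interior of an
edge.
-/

noncomputable section

/-! ### Convexity from local supporting lines -/

/-- A continuous function on an interval that has a local supporting line at every interior point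
is convex: the difference with a chord cannot have a positive maximum, as is seen at the leftmost
point where the maximum is attained. -/
theorem convexOn_Icc_of_eventually_support {F : ℝ → ℝ} {a b : ℝ}
    (hF : ContinuousOn F (Icc a b))
    (hs : ∀ x ∈ Ioo a b, ∃ p : ℝ, ∀ᶠ y in 𝓝 x, F x + p * (y - x) ≤ F y) :
    ConvexOn ℝ (Icc a b) F := by
  refine LinearOrder.convexOn_of_lt (convex_Icc a b) ?_
  intro x hx z hz hxz α β hα hβ hαβ
  by_contra hcon
  push Not at hcon
  simp only [smul_eq_mul] at hcon
  set k : ℝ := (F z - F x) / (z - x) with hk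
  have hzx : 0 < z - x := sub_pos.2 hxz
  have hkz : k * (z - x) = F z - F x := by rw [hk]; field_simp
  set h : ℝ → ℝ := fun u => F u - F x - k * (u - x) with hh
  have hsub : Icc x z ⊆ Icc a b := Icc_subset_Icc hx.1 hz.2
  have hcont : ContinuousOn h (Icc x z) :=
    (((hF.mono hsub).sub continuousOn_const).sub (by fun_prop))
  obtain ⟨u, hu, humax⟩ := isCompact_Icc.exists_isMaxOn (nonempty_Icc.2 hxz.le) hcont
  set w := α * x + β * z with hw
  have hα' : α = 1 - β := by linarith
  have hwx : w - x = β * (z - x) := by rw [hw, hα']; ring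
  have hwI : w ∈ Icc x z := by
    constructor <;> nlinarith
  have hpos : 0 < h u := by
    refine lt_of_lt_of_le ?_ (humax hwI)
    simp only [hh]
    have : k * (w - x) = β * (F z - F x) := by rw [hwx, ← hkz]; ring
    rw [this]
    rw [hα'] at hcon
    linarith
  -- the leftmost point where `h` attains its maximum
  have hclosed : IsClosed (Icc x z ∩ h ⁻¹' {h u}) :=
    hcont.preimage_isClosed_of_isClosed isClosed_Icc isClosed_singleton
  have hcomp : IsCompact (Icc x z ∩ h ⁻¹' {h u}) :=
    isCompact_Icc.of_isClosed_subset hclosed inter_subset_left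
  obtain ⟨s, ⟨hsI, hsu⟩, hsmin⟩ := hcomp.exists_isLeast ⟨u, hu, rfl⟩
  have hsu' : h s = h u := hsu
  have hxs : x < s := by
    refine lt_of_le_of_ne hsI.1 ?_
    rintro rfl
    have : h x = 0 := by simp [hh]
    linarith
  have hsz : s < z := by
    refine lt_of_le_of_ne hsI.2 ?_
    rintro rfl
    have : h s = 0 := by simp only [hh]; linarith
    linarith
  obtain ⟨p, hp⟩ := hs s ⟨hx.1.trans_lt hxs, hsz.trans_le hz.2⟩
  obtain ⟨ε, hε, hball⟩ := Metric.eventually_nhds_iff.1 hp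
  set δ := min (ε / 2) (min (s - x) (z - s)) with hδ
  have hδ0 : 0 < δ := lt_min (by positivity) (lt_min (by linarith) (by linarith))
  have hδ1 : δ ≤ ε / 2 := min_le_left _ _
  have hδ2 : δ ≤ s - x := (min_le_right _ _).trans (min_le_left _ _)
  have hδ3 : δ ≤ z - s := (min_le_right _ _).trans (min_le_right _ _)
  have h1 := hball (y := s - δ) (by
    rw [Real.dist_eq, show s - δ - s = -δ by ring, abs_neg, abs_of_pos hδ0]; linarith)
  have h2 := hball (y := s + δ) (by
    rw [Real.dist_eq, show s + δ - s = δ by ring, abs_of_pos hδ0]; linarith)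
  have hI1 : s - δ ∈ Icc x z := ⟨by linarith, by linarith⟩
  have m1 : h (s - δ) < h s := by
    refine lt_of_le_of_ne (by rw [hsu']; exact humax hI1) fun heq => ?_
    have := hsmin ⟨hI1, show h (s - δ) = h u by rw [heq, hsu']⟩
    linarith
  have m2 : h (s + δ) ≤ h s := by
    rw [hsu']; exact humax (show s + δ ∈ Icc x z from ⟨by linarith, by linarith⟩)
  simp only [hh] at m1 m2
  nlinarith

namespace TropicalCurve

variable {V E : Type*} {G : WeightedGraph V E} (Γ : TropicalCurve G)

/-! ### The metric graph -/

variable {Γ} in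
theorem par_of_nonpos {e : E} {x : ℝ} (h : x ≤ 0) : Γ.par e x = .vertex (G.src e) := by
  rw [par, dif_neg (fun h' => absurd h'.1 (not_lt.2 h)), if_pos h]

variable {Γ} in
theorem par_of_length_le {e : E} {x : ℝ} (h : Γ.length e ≤ x) :
    Γ.par e x = .vertex (G.tgt e) := by
  rw [par, dif_neg (fun h' => absurd h'.2 (not_lt.2 h)),
    if_neg (not_le.2 ((Γ.length_pos e).trans_le h))]

@[simp] theorem par_zero (e : E) : Γ.par e 0 = .vertex (G.src e) := par_of_nonpos le_rfl

@[simp] theorem par_length (e : E) : Γ.par e (Γ.length e) = .vertex (G.tgt e) :=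
  par_of_length_le le_rfl

@[simp] theorem onEdge_zero (f : Γ.Point → ℝ) (e : E) :
    Γ.onEdge f e 0 = f (.vertex (G.src e)) := by simp [onEdge]

@[simp] theorem onEdge_length (f : Γ.Point → ℝ) (e : E) :
    Γ.onEdge f e (Γ.length e) = f (.vertex (G.tgt e)) := by simp [onEdge]

theorem continuous_par (e : E) :
    Continuous (fun x : Icc (0 : ℝ) (Γ.length e) => Γ.par e x) :=
  continuous_iff_coinduced_le.2
    (le_iSup (fun e => TopologicalSpace.coinduced
      (fun x : Icc (0 : ℝ) (Γ.length e) => Γ.par e x) inferInstance) e)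

theorem continuous_point_iff {X : Type*} [TopologicalSpace X] {f : Γ.Point → X} :
    Continuous f ↔ ∀ e, Continuous (fun x : Icc (0 : ℝ) (Γ.length e) => f (Γ.par e x)) := by
  refine continuous_iSup_dom.trans (forall_congr' fun e => ?_)
  exact continuous_coinduced_dom

theorem continuous_iff_onEdge {f : Γ.Point → ℝ} :
    Continuous f ↔ ∀ e, ContinuousOn (Γ.onEdge f e) (Icc 0 (Γ.length e)) := by
  rw [continuous_point_iff]
  exact forall_congr' fun e => (continuousOn_iff_continuous_domRestrict (f := Γ.onEdge f e)).symm

/-! ### Local slopes of rational functions -/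

variable {Γ}

theorem slopeRight_eq {f : Γ.Point → ℝ} {e : E} {x m : ℝ}
    (h : HasDerivWithinAt (Γ.onEdge f e) m (Ioi x) x) : Γ.slopeRight f e x = m :=
  h.derivWithin (uniqueDiffWithinAt_Ioi x)

theorem slopeLeft_eq {f : Γ.Point → ℝ} {e : E} {x m : ℝ}
    (h : HasDerivWithinAt (Γ.onEdge f e) m (Iio x) x) : Γ.slopeLeft f e x = m :=
  h.derivWithin (uniqueDiffWithinAt_Iio x)

theorem hasDerivWithinAt_of_eventually_affine {F : ℝ → ℝ} {s : Set ℝ} {x m : ℝ}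
    (h : ∀ᶠ y in 𝓝[s] x, F y = F x + m * (y - x)) : HasDerivWithinAt F m s x := by
  have h1 : HasDerivWithinAt (fun y => F x + m * (y - x)) m s x := by
    simpa using ((((hasDerivAt_id x).sub_const x).const_mul m).const_add (F x)).hasDerivWithinAt
  exact h1.congr_of_eventuallyEq h (by simp)

/-- To the right of `x`, up to the next break point, a rational function is affine with integer
slope. -/
theorem IsRational.eventually_right {f : Γ.Point → ℝ} (hf : Γ.IsRational f) {e : E} {x : ℝ}
    (hx0 : 0 ≤ x) (hxl : x < Γ.length e) :
    ∃ m : ℤ, ∀ᶠ y in 𝓝[>] x, Γ.onEdge f e y = Γ.onEdge f e x + m * (y - x) := by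
  obtain ⟨S, hS⟩ := hf.2 e
  have h1 : ∀ᶠ b in 𝓝[>] x, ∀ s ∈ S, s ∉ Ioo x b := by
    rw [Filter.eventually_all_finset]
    intro s _
    rcases le_or_gt s x with h | h
    · exact Filter.Eventually.of_forall fun b hb => absurd hb.1 (not_lt.2 h)
    · filter_upwards [Ioo_mem_nhdsGT h] with b hb hb'
      exact absurd hb'.2 (not_lt.2 hb.2.le)
  obtain ⟨b, hb, hxb, hbl⟩ := (h1.and (Ioo_mem_nhdsGT hxl)).exists
  obtain ⟨m, c, hmc⟩ := hS x b hx0 hxb hbl.le hb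
  refine ⟨m, ?_⟩
  filter_upwards [Ioo_mem_nhdsGT hxb] with y hy
  rw [hmc y (Ioo_subset_Icc_self hy), hmc x ⟨le_rfl, hxb.le⟩]
  ring

theorem IsRational.eventually_left {f : Γ.Point → ℝ} (hf : Γ.IsRational f) {e : E} {x : ℝ}
    (hx0 : 0 < x) (hxl : x ≤ Γ.length e) :
    ∃ m : ℤ, ∀ᶠ y in 𝓝[<] x, Γ.onEdge f e y = Γ.onEdge f e x + m * (y - x) := by
  obtain ⟨S, hS⟩ := hf.2 e
  have h1 : ∀ᶠ a in 𝓝[<] x, ∀ s ∈ S, s ∉ Ioo a x := by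
    rw [Filter.eventually_all_finset]
    intro s _
    rcases le_or_gt x s with h | h
    · exact Filter.Eventually.of_forall fun b hb => absurd hb.2 (not_lt.2 h)
    · filter_upwards [Ioo_mem_nhdsLT h] with b hb hb'
      exact absurd hb'.1 (not_lt.2 hb.1.le)
  obtain ⟨a, ha, ha0, hax⟩ := (h1.and (Ioo_mem_nhdsLT hx0)).exists
  obtain ⟨m, c, hmc⟩ := hS a x ha0.le hax hxl ha
  refine ⟨m, ?_⟩
  filter_upwards [Ioo_mem_nhdsLT hax] with y hy
  rw [hmc y (Ioo_subset_Icc_self hy), hmc x ⟨hax.le, le_rfl⟩]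
  ring

theorem IsRational.exists_slopeRight {f : Γ.Point → ℝ} (hf : Γ.IsRational f) {e : E} {x : ℝ}
    (hx0 : 0 ≤ x) (hxl : x < Γ.length e) :
    ∃ m : ℤ, Γ.slopeRight f e x = m ∧ HasDerivWithinAt (Γ.onEdge f e) m (Ioi x) x := by
  obtain ⟨m, hm⟩ := hf.eventually_right hx0 hxl
  have := hasDerivWithinAt_of_eventually_affine hm
  exact ⟨m, slopeRight_eq this, this⟩

theorem IsRational.exists_slopeLeft {f : Γ.Point → ℝ} (hf : Γ.IsRational f) {e : E} {x : ℝ}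
    (hx0 : 0 < x) (hxl : x ≤ Γ.length e) :
    ∃ m : ℤ, Γ.slopeLeft f e x = m ∧ HasDerivWithinAt (Γ.onEdge f e) m (Iio x) x := by
  obtain ⟨m, hm⟩ := hf.eventually_left hx0 hxl
  have := hasDerivWithinAt_of_eventually_affine hm
  exact ⟨m, slopeLeft_eq this, this⟩

/-! ### The canonical divisor -/

theorem canonical_vertex [Fintype V] (v : V) :
    Γ.canonical (.vertex v) = 2 * (G.weight v : ℤ) + G.valence v - 2 := by
  classical
  rw [canonical, Finsupp.finsetSum_apply, Finset.sum_eq_single v]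
  · simp
  · intro b _ hb
    rw [Finsupp.single_apply, if_neg]
    simpa using hb
  · simp

theorem canonical_interior [Fintype V] (e : E) (x : ℝ) (hx : 0 < x ∧ x < Γ.length e) :
    Γ.canonical (.interior e x hx) = 0 := by
  classical
  rw [canonical, Finsupp.finsetSum_apply, Finset.sum_eq_zero]
  intro b _
  rw [Finsupp.single_apply, if_neg]
  simp

theorem sum_valence [Fintype V] [Fintype E] : ∑ v, G.valence v = 2 * Nat.card E := by
  classical
  have h (g : E → V) : ∑ v, Nat.card {e : E // g e = v} = Nat.card E := by
    rw [← Nat.card_congr (Equiv.sigmaFiberEquiv g), Nat.card_sigma]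
  simp only [WeightedGraph.valence, Finset.sum_add_distrib, h]
  ring

theorem sum_canonical [Fintype V] [Fintype E] (hconn : G.Connected) (hgenus : G.genus = 2) :
    ∑ v, Γ.canonical (.vertex v) = 2 := by
  have h := sum_valence (G := G)
  zify at h
  simp only [canonical_vertex, Finset.sum_sub_distrib, Finset.sum_add_distrib, h,
    ← Finset.mul_sum, Finset.sum_const, Finset.card_univ, nsmul_eq_mul]
  rw [WeightedGraph.genus, WeightedGraph.betti, hconn, Nat.card_eq_fintype_card (α := V)] at hgenus
  push_cast at hgenus
  linarith

theorem one_le_canonical [Fintype V] (hstable : G.Stable) (v : V) :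
    1 ≤ Γ.canonical (.vertex v) := by
  have := hstable v
  rw [canonical_vertex]
  lia

/-! ### Effective canonical divisors -/

variable [Fintype E] [DecidableEq V]

theorem ord_interior {f : Γ.Point → ℝ} (e : E) (x : ℝ) (hx : 0 < x ∧ x < Γ.length e) :
    Γ.ord f (.interior e x hx) = Γ.slopeRight f e x + -Γ.slopeLeft f e x := by
  simp only [ord]

theorem IsAddDiv.slopeLeft_le_slopeRight [Fintype V] {f : Γ.Point → ℝ} {D : Γ.Divisor}
    (hD : Γ.IsAddDiv Γ.canonical f D) (h0 : 0 ≤ D) {e : E} {x : ℝ}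
    (hx : 0 < x ∧ x < Γ.length e) : Γ.slopeLeft f e x ≤ Γ.slopeRight f e x := by
  have h1 := hD (.interior e x hx)
  rw [canonical_interior e x hx, ord_interior e x hx] at h1
  have h2 : (0 : ℝ) ≤ D (.interior e x hx) := by exact_mod_cast h0 _
  push_cast at h1
  linarith

/-- If `K + (f)` is effective then `f` is convex on every edge, as `K` vanishes there. -/
theorem IsAddDiv.convexOn [Fintype V] {f : Γ.Point → ℝ} (hf : Γ.IsRational f) {D : Γ.Divisor}
    (hD : Γ.IsAddDiv Γ.canonical f D) (h0 : 0 ≤ D) (e : E) :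
    ConvexOn ℝ (Icc 0 (Γ.length e)) (Γ.onEdge f e) := by
  refine convexOn_Icc_of_eventually_support (Γ.continuous_iff_onEdge.1 hf.1 e) ?_
  intro x hx
  obtain ⟨m, hm⟩ := hf.eventually_right hx.1.le hx.2
  obtain ⟨n, hn⟩ := hf.eventually_left hx.1 hx.2.le
  have h3 := hD.slopeLeft_le_slopeRight h0 hx
  rw [slopeRight_eq (hasDerivWithinAt_of_eventually_affine hm),
    slopeLeft_eq (hasDerivWithinAt_of_eventually_affine hn)] at h3
  refine ⟨n, ?_⟩
  rw [← nhdsLT_sup_nhdsGE, Filter.eventually_sup, ← Ioi_insert, nhdsWithin_insert,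
    Filter.eventually_sup]
  refine ⟨?_, by simp, ?_⟩
  · filter_upwards [hn] with y hy
    rw [hy]
  · filter_upwards [hm, self_mem_nhdsWithin] with y hy hxy
    rw [hy]
    have : 0 < y - x := sub_pos.2 hxy
    nlinarith

theorem IsAddDiv.slopeRight_mul_le [Fintype V] {f : Γ.Point → ℝ} (hf : Γ.IsRational f)
    {D : Γ.Divisor} (hD : Γ.IsAddDiv Γ.canonical f D) (h0 : 0 ≤ D) {e : E} {x y : ℝ}
    (hx : 0 ≤ x) (hxy : x < y) (hy : y ≤ Γ.length e) :
    Γ.slopeRight f e x * (y - x) ≤ Γ.onEdge f e y - Γ.onEdge f e x := by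
  obtain ⟨m, hm, hm'⟩ := hf.exists_slopeRight (e := e) hx (hxy.trans_le hy)
  have := (hD.convexOn hf h0 e).le_slope_of_hasDerivWithinAt_Ioi ⟨hx, hxy.le.trans hy⟩
    ⟨hx.trans hxy.le, hy⟩ hxy hm'
  rwa [slope_def_field, le_div_iff₀ (sub_pos.2 hxy), ← hm] at this

theorem IsAddDiv.le_slopeLeft_mul [Fintype V] {f : Γ.Point → ℝ} (hf : Γ.IsRational f)
    {D : Γ.Divisor} (hD : Γ.IsAddDiv Γ.canonical f D) (h0 : 0 ≤ D) {e : E} {x y : ℝ}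
    (hx : 0 ≤ x) (hxy : x < y) (hy : y ≤ Γ.length e) :
    Γ.onEdge f e y - Γ.onEdge f e x ≤ Γ.slopeLeft f e y * (y - x) := by
  obtain ⟨m, hm, hm'⟩ := hf.exists_slopeLeft (e := e) (hx.trans_lt hxy) hy
  have := (hD.convexOn hf h0 e).slope_le_of_hasDerivWithinAt_Iio ⟨hx, hxy.le.trans hy⟩
    ⟨hx.trans hxy.le, hy⟩ hxy hm'
  rwa [slope_def_field, div_le_iff₀ (sub_pos.2 hxy), ← hm] at this

/-- The contribution of the edge `e` to the order of `f` at the vertex `v`. -/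
def outSlope (f : Γ.Point → ℝ) (v : V) (e : E) : ℝ :=
  (if G.src e = v then Γ.slopeRight f e 0 else 0) +
    if G.tgt e = v then -Γ.slopeLeft f e (Γ.length e) else 0


theorem ord_vertex (f : Γ.Point → ℝ) (v : V) :
    Γ.ord f (.vertex v) = ∑ e, outSlope f v e := by
  simp only [ord, outSlope, Finset.sum_add_distrib]

/-- At a vertex where `f` is maximal among the vertices, no edge has positive outgoing slope. -/
theorem IsAddDiv.outSlope_nonpos [Fintype V] {f : Γ.Point → ℝ} (hf : Γ.IsRational f)
    {D : Γ.Divisor} (hD : Γ.IsAddDiv Γ.canonical f D) (h0 : 0 ≤ D) {v : V}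
    (hv : ∀ u, f (.vertex u) ≤ f (.vertex v)) (e : E) : outSlope f v e ≤ 0 := by
  have hl := Γ.length_pos e
  have h1 := hD.slopeRight_mul_le hf h0 (e := e) le_rfl hl le_rfl
  have h2 := hD.le_slopeLeft_mul hf h0 (e := e) le_rfl hl le_rfl
  simp only [onEdge_zero, onEdge_length, sub_zero] at h1 h2
  have h3 : G.src e = v → Γ.slopeRight f e 0 ≤ 0 := by
    rintro rfl
    have := hv (G.tgt e)
    by_contra! hc
    nlinarith [mul_pos hc hl]
  have h4 : G.tgt e = v → 0 ≤ Γ.slopeLeft f e (Γ.length e) := by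
    rintro rfl
    have := hv (G.src e)
    by_contra! hc
    nlinarith [mul_neg_of_neg_of_pos hc hl]
  rw [outSlope]
  split_ifs with ha hb hb
  · linarith [h3 ha, h4 hb]
  · linarith [h3 ha]
  · linarith [h4 hb]
  · simp

/-- An edge from a maximal vertex to a strictly lower one has outgoing slope at most `-1`, slopes
being integers. -/
theorem IsAddDiv.outSlope_le_neg_one [Fintype V] {f : Γ.Point → ℝ} (hf : Γ.IsRational f)
    {D : Γ.Divisor} (hD : Γ.IsAddDiv Γ.canonical f D) (h0 : 0 ≤ D) {v : V}
    (hv : ∀ u, f (.vertex u) ≤ f (.vertex v)) {e : E}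
    (he : f (.vertex (G.src e)) ≠ f (.vertex (G.tgt e))) (hev : G.src e = v ∨ G.tgt e = v) :
    outSlope f v e ≤ -1 := by
  have hl := Γ.length_pos e
  have h1 := hD.slopeRight_mul_le hf h0 (e := e) le_rfl hl le_rfl
  have h2 := hD.le_slopeLeft_mul hf h0 (e := e) le_rfl hl le_rfl
  simp only [onEdge_zero, onEdge_length, sub_zero] at h1 h2
  obtain ⟨m, hm, -⟩ := hf.exists_slopeRight (e := e) le_rfl hl
  obtain ⟨n, hn, -⟩ := hf.exists_slopeLeft (e := e) hl le_rfl
  rw [outSlope, hm, hn]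
  rw [hm] at h1
  rw [hn] at h2
  have hne : G.src e ≠ G.tgt e := fun h => he (by rw [h])
  rcases hev with rfl | rfl
  · rw [if_pos rfl, if_neg hne.symm, add_zero]
    have h3 : (m : ℝ) < 0 := by
      have := lt_of_le_of_ne (hv (G.tgt e)) he.symm
      by_contra! hc
      nlinarith [mul_nonneg hc hl.le]
    have : m < 0 := by exact_mod_cast h3
    exact_mod_cast (by lia : m ≤ -1)
  · rw [if_pos rfl, if_neg hne, zero_add]
    have h3 : (0 : ℝ) < n := by
      have := lt_of_le_of_ne (hv (G.src e)) he
      by_contra! hc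
      nlinarith [mul_nonneg (neg_nonneg.2 hc) hl.le]
    have : 0 < n := by exact_mod_cast h3
    exact_mod_cast (by lia : -n ≤ -1)

/-- In genus two, a rational function `f` with `K + (f)` effective takes different values at the
ends of at most one edge. -/
theorem IsAddDiv.edge_unique [Fintype V] (hconn : G.Connected) (hstable : G.Stable)
    (hgenus : G.genus = 2) {f : Γ.Point → ℝ} (hf : Γ.IsRational f)
    {D : Γ.Divisor} (hD : Γ.IsAddDiv Γ.canonical f D) (h0 : 0 ≤ D) {e₁ e₂ : E}
    (h₁ : f (.vertex (G.src e₁)) ≠ f (.vertex (G.tgt e₁)))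
    (h₂ : f (.vertex (G.src e₂)) ≠ f (.vertex (G.tgt e₂))) : e₁ = e₂ := by
  classical
  by_contra hne
  have hK := sum_canonical (Γ := Γ) hconn hgenus
  have hK1 := one_le_canonical (Γ := Γ) hstable
  have hsub (s : Finset V) : ∑ v ∈ s, Γ.canonical (.vertex v) ≤ 2 := by
    rw [← hK]
    exact Finset.sum_le_sum_of_subset_of_nonneg (Finset.subset_univ s)
      fun v _ _ => zero_le_one.trans (hK1 v)
  obtain ⟨w, -, hw⟩ := Finset.exists_max_image Finset.univ (fun v => f (.vertex v))
    ⟨G.src e₁, Finset.mem_univ _⟩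
  simp only [Finset.mem_univ, true_imp_iff] at hw
  -- the coefficients of `K` are positive with sum two, so there are at most two vertices
  have hinc {e : E} (he : f (.vertex (G.src e)) ≠ f (.vertex (G.tgt e))) :
      G.src e = w ∨ G.tgt e = w := by
    have hne : G.src e ≠ G.tgt e := fun h => he (by rw [h])
    by_contra! hc
    have := hsub {w, G.src e, G.tgt e}
    rw [Finset.sum_insert (by simp [hc.1.symm, hc.2.symm]), Finset.sum_pair hne] at this
    linarith [hK1 w, hK1 (G.src e), hK1 (G.tgt e)]
  have hKw : Γ.canonical (.vertex w) ≤ 1 := by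
    have hne : G.src e₁ ≠ G.tgt e₁ := fun h => h₁ (by rw [h])
    have := hsub {G.src e₁, G.tgt e₁}
    rw [Finset.sum_pair hne] at this
    rcases hinc h₁ with h | h
    · rw [← h]; linarith [hK1 (G.tgt e₁)]
    · rw [← h]; linarith [hK1 (G.src e₁)]
  have hsum : ∑ e, outSlope f w e ≤
      ∑ e, ((if e = e₁ then (-1 : ℝ) else 0) + if e = e₂ then (-1 : ℝ) else 0) := by
    refine Finset.sum_le_sum fun e _ => ?_
    split_ifs with ha hb hb
    · exact absurd (ha.symm.trans hb) hne
    · subst ha; simpa using hD.outSlope_le_neg_one hf h0 hw h₁ (hinc h₁)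
    · subst hb; simpa using hD.outSlope_le_neg_one hf h0 hw h₂ (hinc h₂)
    · simpa using hD.outSlope_nonpos hf h0 hw e
  rw [Finset.sum_add_distrib] at hsum
  simp only [Finset.sum_ite_eq', Finset.mem_univ, if_true] at hsum
  have h3 := hD (.vertex w)
  rw [ord_vertex] at h3
  have h4 : (0 : ℝ) ≤ D (.vertex w) := by exact_mod_cast h0 _
  have h5 : (Γ.canonical (.vertex w) : ℝ) ≤ 1 := by exact_mod_cast hKw
  linarith

end TropicalCurve

namespace TropicalCurve

open scoped Pointwise

variable {V E : Type*} {G : WeightedGraph V E}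

/-! ### Rescaling the edges -/

/-- The factor by which the edge `e` is stretched when passing from `Γ₁` to `Γ₂`. -/
def ratio (Γ₁ Γ₂ : TropicalCurve G) (e : E) : ℝ := Γ₂.length e / Γ₁.length e

theorem ratio_pos (Γ₁ Γ₂ : TropicalCurve G) (e : E) : 0 < Γ₁.ratio Γ₂ e :=
  div_pos (Γ₂.length_pos e) (Γ₁.length_pos e)

theorem ratio_mul_length (Γ₁ Γ₂ : TropicalCurve G) (e : E) :
    Γ₁.ratio Γ₂ e * Γ₁.length e = Γ₂.length e :=
  div_mul_cancel₀ _ (Γ₁.length_pos e).ne'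

theorem inv_ratio (Γ₁ Γ₂ : TropicalCurve G) (e : E) :
    (Γ₁.ratio Γ₂ e)⁻¹ = Γ₂.ratio Γ₁ e := inv_div _ _

theorem ratio_mul_ratio (Γ₁ Γ₂ : TropicalCurve G) (e : E) :
    Γ₂.ratio Γ₁ e * Γ₁.ratio Γ₂ e = 1 := by
  rw [← inv_ratio, inv_mul_cancel₀ (ratio_pos _ _ _).ne']

theorem ratio_mul_mem_Icc (Γ₁ Γ₂ : TropicalCurve G) {e : E} {x : ℝ}
    (hx : x ∈ Icc (0 : ℝ) (Γ₁.length e)) : Γ₁.ratio Γ₂ e * x ∈ Icc (0 : ℝ) (Γ₂.length e) := by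
  have hr := ratio_pos Γ₁ Γ₂ e
  refine ⟨mul_nonneg hr.le hx.1, ?_⟩
  rw [← ratio_mul_length Γ₁ Γ₂ e]
  exact mul_le_mul_of_nonneg_left hx.2 hr.le

/-- The homeomorphism between two tropical curves with the same model that stretches every edge
linearly. -/
def rescale (Γ₁ Γ₂ : TropicalCurve G) : Γ₁.Point → Γ₂.Point
  | .vertex v => .vertex v
  | .interior e x _ => Γ₂.par e (Γ₁.ratio Γ₂ e * x)

theorem rescale_vertex (Γ₁ Γ₂ : TropicalCurve G) (v : V) :
    Γ₁.rescale Γ₂ (.vertex v) = .vertex v := rfl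

theorem rescale_par (Γ₁ Γ₂ : TropicalCurve G) (e : E) (x : ℝ) :
    Γ₁.rescale Γ₂ (Γ₁.par e x) = Γ₂.par e (Γ₁.ratio Γ₂ e * x) := by
  have hr := ratio_pos Γ₁ Γ₂ e
  rcases le_or_gt x 0 with h | h
  · rw [par_of_nonpos h, par_of_nonpos (mul_nonpos_of_nonneg_of_nonpos hr.le h), rescale_vertex]
  rcases le_or_gt (Γ₁.length e) x with h' | h'
  · rw [par_of_length_le h', rescale_vertex, par_of_length_le]
    rw [← ratio_mul_length Γ₁ Γ₂ e]
    exact mul_le_mul_of_nonneg_left h' hr.le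
  · rw [par_of_mem Γ₁ ⟨h, h'⟩, rescale]

theorem rescale_rescale (Γ₁ Γ₂ : TropicalCurve G) (p : Γ₁.Point) :
    Γ₂.rescale Γ₁ (Γ₁.rescale Γ₂ p) = p := by
  cases p with
  | vertex v => rfl
  | interior e x hx =>
    rw [rescale.eq_2, rescale_par, ← mul_assoc, ratio_mul_ratio, one_mul, par_of_mem _ hx]

theorem rescale_injective (Γ₁ Γ₂ : TropicalCurve G) : Function.Injective (Γ₁.rescale Γ₂) :=
  Function.LeftInverse.injective (rescale_rescale Γ₁ Γ₂)

theorem continuous_rescale (Γ₁ Γ₂ : TropicalCurve G) : Continuous (Γ₁.rescale Γ₂) := by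
  rw [continuous_point_iff]
  intro e
  simp only [rescale_par]
  exact (Γ₂.continuous_par e).comp
    (Continuous.subtype_mk (f := fun x : Icc (0 : ℝ) (Γ₁.length e) => Γ₁.ratio Γ₂ e * x)
      (by fun_prop) fun x => ratio_mul_mem_Icc Γ₁ Γ₂ x.2)

/-- The map on divisors induced by `rescale`. -/
def rescaleDiv (Γ₁ Γ₂ : TropicalCurve G) (D : Γ₁.Divisor) : Γ₂.Divisor :=
  Finsupp.mapDomain (Γ₁.rescale Γ₂) D

theorem rescaleDiv_apply (Γ₁ Γ₂ : TropicalCurve G) (D : Γ₁.Divisor) (p : Γ₁.Point) :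
    Γ₁.rescaleDiv Γ₂ D (Γ₁.rescale Γ₂ p) = D p :=
  Finsupp.mapDomain_apply (rescale_injective Γ₁ Γ₂) D p

theorem rescaleDiv_par (Γ₁ Γ₂ : TropicalCurve G) (D : Γ₁.Divisor) (e : E) (x : ℝ) :
    Γ₁.rescaleDiv Γ₂ D (Γ₂.par e (Γ₁.ratio Γ₂ e * x)) = D (Γ₁.par e x) := by
  rw [← rescale_par, rescaleDiv_apply]

theorem rescaleDiv_rescaleDiv (Γ₁ Γ₂ : TropicalCurve G) (D : Γ₁.Divisor) :
    Γ₂.rescaleDiv Γ₁ (Γ₁.rescaleDiv Γ₂ D) = D := by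
  ext p
  conv_lhs => rw [← rescale_rescale Γ₁ Γ₂ p]
  rw [rescaleDiv_apply, rescaleDiv_apply]

theorem continuous_rescaleDiv (Γ₁ Γ₂ : TropicalCurve G) :
    @Continuous _ _ Γ₁.divisorTopology Γ₂.divisorTopology (Γ₁.rescaleDiv Γ₂) := by
  let _ := Γ₁.divisorTopology
  let _ := Γ₂.divisorTopology
  refine continuous_iSup_dom.2 fun n => continuous_coinduced_dom.2 ?_
  have h1 : Continuous (fun p : Fin n → Γ₂.Point => ∑ i, Finsupp.single (p i) (1 : ℤ)) :=
    continuous_iff_coinduced_le.2 (le_iSup (fun n : ℕ => TopologicalSpace.coinduced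
      (fun p : Fin n → Γ₂.Point => ∑ i, Finsupp.single (p i) (1 : ℤ)) inferInstance) n)
  have h2 : Continuous (fun (p : Fin n → Γ₁.Point) (i : Fin n) => Γ₁.rescale Γ₂ (p i)) :=
    continuous_pi fun i => (continuous_rescale Γ₁ Γ₂).comp (continuous_apply i)
  have h3 := h1.comp h2
  refine h3.congr fun p => ?_
  simp only [Function.comp_apply, rescaleDiv, Finsupp.mapDomain_finsetSum,
    Finsupp.mapDomain_single]

theorem positions_rescaleDiv (Γ₁ Γ₂ : TropicalCurve G) (D : Γ₁.Divisor) (e : E) :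
    Γ₂.positions (Γ₁.rescaleDiv Γ₂ D) e = (Γ₁.positions D e).map (Γ₁.ratio Γ₂ e * ·) := by
  have hr := ratio_pos Γ₁ Γ₂ e
  have hmono : StrictMono (Γ₁.ratio Γ₂ e * ·) := fun x y h => mul_lt_mul_of_pos_left h hr
  have := StrictMonoOn.map_finsetSort (s := (Γ₁.finite_positions D e).toFinset)
    (f := ⟨(Γ₁.ratio Γ₂ e * ·), hmono.injective⟩) (hmono.strictMonoOn _)
  rw [positions, positions]
  refine Eq.trans ?_ this.symm
  congr 1
  ext y
  simp only [Finite.mem_toFinset, mem_ofPred_eq, Finset.mem_map, Function.Embedding.coeFn_mk]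
  constructor
  · rintro ⟨⟨h1, h2⟩, h3⟩
    have hy : Γ₁.ratio Γ₂ e * ((Γ₁.ratio Γ₂ e)⁻¹ * y) = y := by
      rw [mul_inv_cancel_left₀ hr.ne']
    refine ⟨(Γ₁.ratio Γ₂ e)⁻¹ * y, ⟨⟨by positivity, ?_⟩, ?_⟩, hy⟩
    · rw [inv_mul_lt_iff₀ hr, ratio_mul_length]
      exact h2
    · rwa [← rescaleDiv_par Γ₁ Γ₂, hy]
  · rintro ⟨x, ⟨⟨h1, h2⟩, h3⟩, rfl⟩
    refine ⟨⟨by positivity, ?_⟩, by rwa [rescaleDiv_par]⟩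
    rw [← ratio_mul_length Γ₁ Γ₂ e]
    exact mul_lt_mul_of_pos_left h2 hr

theorem coords_rescaleDiv (Γ₁ Γ₂ : TropicalCurve G) (c : CellData V E) (D : Γ₁.Divisor)
    (q : Σ e : E, Fin (c.mults e).length) :
    Γ₂.coords c (Γ₁.rescaleDiv Γ₂ D) q = Γ₁.ratio Γ₂ q.1 * Γ₁.coords c D q := by
  have := List.getD_map (l := Γ₁.positions D q.1) (d := 0) (n := q.2) (f := (Γ₁.ratio Γ₂ q.1 * ·))
  rw [mul_zero] at this
  rw [coords, coords, positions_rescaleDiv, this]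

theorem rescaleDiv_canonical [Fintype V] (Γ₁ Γ₂ : TropicalCurve G) :
    Γ₁.rescaleDiv Γ₂ Γ₁.canonical = Γ₂.canonical := by
  simp only [rescaleDiv, canonical, Finsupp.mapDomain_finsetSum, Finsupp.mapDomain_single,
    rescale_vertex]

/-! ### Rescaling rational functions -/

/-- The function on `Γ₂` with the slopes of the function `f` on `Γ₁`; its value at the vertex `v`
is `ρ * f v`. For this to be continuous `ρ` has to be the stretching factor of every edge along
which `f` is not constant on the end points. -/
def rescaleFun (Γ₁ Γ₂ : TropicalCurve G) (ρ : ℝ) (f : Γ₁.Point → ℝ) : Γ₂.Point → ℝ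
  | .vertex v => ρ * f (.vertex v)
  | .interior e y _ => Γ₁.ratio Γ₂ e *
      (f (Γ₁.par e (Γ₂.ratio Γ₁ e * y)) - f (.vertex (G.src e))) + ρ * f (.vertex (G.src e))

theorem onEdge_rescaleFun (Γ₁ Γ₂ : TropicalCurve G) {ρ : ℝ} {f : Γ₁.Point → ℝ}
    (hρ : ∀ e, ρ * (f (.vertex (G.tgt e)) - f (.vertex (G.src e))) =
      Γ₁.ratio Γ₂ e * (f (.vertex (G.tgt e)) - f (.vertex (G.src e)))) (e : E) :
    Γ₂.onEdge (Γ₁.rescaleFun Γ₂ ρ f) e = fun y => Γ₁.ratio Γ₂ e *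
      (Γ₁.onEdge f e (Γ₂.ratio Γ₁ e * y) - f (.vertex (G.src e))) +
        ρ * f (.vertex (G.src e)) := by
  have hr := ratio_pos Γ₂ Γ₁ e
  funext y
  rw [onEdge, onEdge]
  rcases le_or_gt y 0 with h | h
  · rw [par_of_nonpos h, par_of_nonpos (mul_nonpos_of_nonneg_of_nonpos hr.le h)]
    simp [rescaleFun]
  rcases le_or_gt (Γ₂.length e) y with h' | h'
  · have h2 : Γ₁.length e ≤ Γ₂.ratio Γ₁ e * y := by
      rw [← ratio_mul_length Γ₂ Γ₁ e]
      exact mul_le_mul_of_nonneg_left h' hr.le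
    rw [par_of_length_le h', par_of_length_le h2, rescaleFun, ← hρ e]
    ring
  · rw [par_of_mem Γ₂ ⟨h, h'⟩, rescaleFun]

theorem isRational_rescaleFun (Γ₁ Γ₂ : TropicalCurve G) {ρ : ℝ} {f : Γ₁.Point → ℝ}
    (hf : Γ₁.IsRational f)
    (hρ : ∀ e, ρ * (f (.vertex (G.tgt e)) - f (.vertex (G.src e))) =
      Γ₁.ratio Γ₂ e * (f (.vertex (G.tgt e)) - f (.vertex (G.src e)))) :
    Γ₂.IsRational (Γ₁.rescaleFun Γ₂ ρ f) := by
  classical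
  refine ⟨?_, fun e => ?_⟩
  · rw [continuous_iff_onEdge]
    intro e
    rw [onEdge_rescaleFun Γ₁ Γ₂ hρ]
    have h1 : ContinuousOn (fun y => Γ₁.onEdge f e (Γ₂.ratio Γ₁ e * y))
        (Icc 0 (Γ₂.length e)) :=
      ((Γ₁.continuous_iff_onEdge.1 hf.1) e).comp (by fun_prop)
        fun x hx => ratio_mul_mem_Icc Γ₂ Γ₁ hx
    exact (continuousOn_const.mul (h1.sub continuousOn_const)).add continuousOn_const
  · have hr := ratio_pos Γ₂ Γ₁ e
    have hr' := ratio_pos Γ₁ Γ₂ e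
    obtain ⟨S, hS⟩ := hf.2 e
    refine ⟨S.image (Γ₁.ratio Γ₂ e * ·), fun a b ha hab hb hs => ?_⟩
    obtain ⟨m, c, hmc⟩ := hS (Γ₂.ratio Γ₁ e * a) (Γ₂.ratio Γ₁ e * b) (by positivity)
      (mul_lt_mul_of_pos_left hab hr)
      (ratio_mul_mem_Icc Γ₂ Γ₁ ⟨ha.trans hab.le, hb⟩).2 (fun s hsS hsI => by
        refine hs _ (Finset.mem_image_of_mem _ hsS) ?_
        rw [← inv_ratio Γ₁ Γ₂, mem_Ioo, inv_mul_lt_iff₀ hr', lt_inv_mul_iff₀ hr'] at hsI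
        exact hsI)
    refine ⟨m, Γ₁.ratio Γ₂ e * (c - f (.vertex (G.src e))) + ρ * f (.vertex (G.src e)),
      fun x hx => ?_⟩
    rw [onEdge_rescaleFun Γ₁ Γ₂ hρ]
    simp only
    rw [hmc _ ⟨mul_le_mul_of_nonneg_left hx.1 hr.le, mul_le_mul_of_nonneg_left hx.2 hr.le⟩]
    linear_combination (m : ℝ) * x * ratio_mul_ratio Γ₁ Γ₂ e

theorem derivWithin_rescale {F : ℝ → ℝ} {r r' : ℝ} (hr : r * r' = 1) (a c : ℝ) (s : Set ℝ)
    (x : ℝ) : derivWithin (fun y => r * (F (r' * y) - a) + c) s x =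
      derivWithin F (r' • s) (r' * x) := by
  rw [derivWithin_add_const, derivWithin_const_mul_field, derivWithin_sub_const,
    derivWithin_comp_mul_left r' F]
  rw [smul_eq_mul, ← mul_assoc, hr, one_mul]

theorem slopeRight_rescaleFun (Γ₁ Γ₂ : TropicalCurve G) {ρ : ℝ} {f : Γ₁.Point → ℝ}
    (hρ : ∀ e, ρ * (f (.vertex (G.tgt e)) - f (.vertex (G.src e))) =
      Γ₁.ratio Γ₂ e * (f (.vertex (G.tgt e)) - f (.vertex (G.src e)))) (e : E) (x : ℝ) :
    Γ₂.slopeRight (Γ₁.rescaleFun Γ₂ ρ f) e (Γ₁.ratio Γ₂ e * x) = Γ₁.slopeRight f e x := by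
  rw [slopeRight, slopeRight, onEdge_rescaleFun Γ₁ Γ₂ hρ,
    derivWithin_rescale (ratio_mul_ratio Γ₂ Γ₁ e), LinearOrderedField.smul_Ioi
      (ratio_pos Γ₂ Γ₁ e), ← mul_assoc, ratio_mul_ratio, one_mul]

theorem slopeLeft_rescaleFun (Γ₁ Γ₂ : TropicalCurve G) {ρ : ℝ} {f : Γ₁.Point → ℝ}
    (hρ : ∀ e, ρ * (f (.vertex (G.tgt e)) - f (.vertex (G.src e))) =
      Γ₁.ratio Γ₂ e * (f (.vertex (G.tgt e)) - f (.vertex (G.src e)))) (e : E) (x : ℝ) :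
    Γ₂.slopeLeft (Γ₁.rescaleFun Γ₂ ρ f) e (Γ₁.ratio Γ₂ e * x) = Γ₁.slopeLeft f e x := by
  rw [slopeLeft, slopeLeft, onEdge_rescaleFun Γ₁ Γ₂ hρ,
    derivWithin_rescale (ratio_mul_ratio Γ₂ Γ₁ e), LinearOrderedField.smul_Iio
      (ratio_pos Γ₂ Γ₁ e), ← mul_assoc, ratio_mul_ratio, one_mul]

variable [Fintype E] [DecidableEq V]

theorem ord_rescaleFun (Γ₁ Γ₂ : TropicalCurve G) {ρ : ℝ} {f : Γ₁.Point → ℝ}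
    (hρ : ∀ e, ρ * (f (.vertex (G.tgt e)) - f (.vertex (G.src e))) =
      Γ₁.ratio Γ₂ e * (f (.vertex (G.tgt e)) - f (.vertex (G.src e)))) (p : Γ₁.Point) :
    Γ₂.ord (Γ₁.rescaleFun Γ₂ ρ f) (Γ₁.rescale Γ₂ p) = Γ₁.ord f p := by
  have hR := slopeRight_rescaleFun Γ₁ Γ₂ hρ
  have hL := slopeLeft_rescaleFun Γ₁ Γ₂ hρ
  cases p with
  | vertex v =>
    have hR0 (e : E) := hR e 0
    have hLl (e : E) := hL e (Γ₁.length e)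
    simp only [mul_zero, ratio_mul_length] at hR0 hLl
    simp only [rescale_vertex, ord, hR0, hLl]
  | interior e x hx =>
    rw [rescale, par_of_mem Γ₂ (e := e) (x := Γ₁.ratio Γ₂ e * x)
      ⟨mul_pos (ratio_pos Γ₁ Γ₂ e) hx.1, by
        rw [← ratio_mul_length Γ₁ Γ₂ e]
        exact mul_lt_mul_of_pos_left hx.2 (ratio_pos Γ₁ Γ₂ e)⟩, ord_interior, ord_interior, hR, hL]

variable [Fintype V]

/-- Stretching the edges preserves the cells: a suitable rational function on `Γ₂` has the slopes of
the one on `Γ₁`. -/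
theorem rescaleDiv_mem_cell (hconn : G.Connected) (hstable : G.Stable) (hgenus : G.genus = 2)
    (Γ₁ Γ₂ : TropicalCurve G) {c : CellData V E} {D : Γ₁.Divisor}
    (hD : D ∈ Γ₁.cell Γ₁.canonical c) : Γ₁.rescaleDiv Γ₂ D ∈ Γ₂.cell Γ₂.canonical c := by
  obtain ⟨h0, f, hf, hdiv, hv, hs, hm⟩ := hD
  -- `f` is not constant on the end points of at most one edge, whose stretching factor is `ρ`
  obtain ⟨ρ, hρ⟩ : ∃ ρ : ℝ, ∀ e, ρ * (f (.vertex (G.tgt e)) - f (.vertex (G.src e))) =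
      Γ₁.ratio Γ₂ e * (f (.vertex (G.tgt e)) - f (.vertex (G.src e))) := by
    by_cases h : ∃ e, f (.vertex (G.src e)) ≠ f (.vertex (G.tgt e))
    · obtain ⟨e₀, he₀⟩ := h
      refine ⟨Γ₁.ratio Γ₂ e₀, fun e => ?_⟩
      by_cases he : f (.vertex (G.src e)) = f (.vertex (G.tgt e))
      · simp [he]
      · rw [hdiv.edge_unique hconn hstable hgenus hf h0 he he₀]
    · push Not at h
      exact ⟨0, fun e => by simp [h e]⟩
  refine ⟨fun p => ?_, Γ₁.rescaleFun Γ₂ ρ f, isRational_rescaleFun Γ₁ Γ₂ hf hρ, fun p => ?_,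
    fun v => ?_, fun e => ?_, fun e => ?_⟩
  · rw [← rescale_rescale Γ₂ Γ₁ p, rescaleDiv_apply]
    exact h0 _
  · rw [← rescale_rescale Γ₂ Γ₁ p, rescaleDiv_apply, ord_rescaleFun Γ₁ Γ₂ hρ,
      ← rescaleDiv_canonical Γ₁ Γ₂, rescaleDiv_apply]
    exact hdiv _
  · rw [← rescale_vertex Γ₁ Γ₂, rescaleDiv_apply, hv]
  · rw [← hs e, ← slopeRight_rescaleFun Γ₁ Γ₂ hρ, mul_zero]
  · rw [positions_rescaleDiv, List.map_map, ← hm e]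
    refine List.map_congr_left fun x _ => ?_
    rw [Function.comp_apply, rescaleDiv_par]

theorem cell_eq_preimage (hconn : G.Connected) (hstable : G.Stable) (hgenus : G.genus = 2)
    (Γ₁ Γ₂ : TropicalCurve G) (c : CellData V E) :
    Γ₁.cell Γ₁.canonical c = Γ₁.rescaleDiv Γ₂ ⁻¹' Γ₂.cell Γ₂.canonical c := by
  ext D
  refine ⟨rescaleDiv_mem_cell hconn hstable hgenus Γ₁ Γ₂, fun h => ?_⟩
  rw [← rescaleDiv_rescaleDiv Γ₁ Γ₂ D]
  exact rescaleDiv_mem_cell hconn hstable hgenus Γ₂ Γ₁ h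

theorem cell_eq_image (hconn : G.Connected) (hstable : G.Stable) (hgenus : G.genus = 2)
    (Γ₁ Γ₂ : TropicalCurve G) (c : CellData V E) :
    Γ₂.cell Γ₂.canonical c = Γ₁.rescaleDiv Γ₂ '' Γ₁.cell Γ₁.canonical c := by
  rw [cell_eq_preimage hconn hstable hgenus Γ₁ Γ₂ c, image_preimage_eq]
  exact fun D => ⟨_, rescaleDiv_rescaleDiv Γ₂ Γ₁ D⟩

theorem cells_subset (hconn : G.Connected) (hstable : G.Stable) (hgenus : G.genus = 2)
    (Γ₁ Γ₂ : TropicalCurve G) : Γ₁.cells Γ₁.canonical ⊆ Γ₂.cells Γ₂.canonical :=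
  fun _ ⟨_, hD⟩ => ⟨_, rescaleDiv_mem_cell hconn hstable hgenus Γ₁ Γ₂ hD⟩

theorem cellDim_eq (hconn : G.Connected) (hstable : G.Stable) (hgenus : G.genus = 2)
    (Γ₁ Γ₂ : TropicalCurve G) (c : CellData V E) :
    Γ₁.cellDim Γ₁.canonical c = Γ₂.cellDim Γ₂.canonical c := by
  let L : ((Σ e : E, Fin (c.mults e).length) → ℝ) ≃ₗ[ℝ] ((Σ e : E, Fin (c.mults e).length) → ℝ) :=
    LinearEquiv.piCongrRight fun q =>
      LinearEquiv.smulOfNeZero ℝ ℝ (Γ₁.ratio Γ₂ q.1) (ratio_pos Γ₁ Γ₂ q.1).ne'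
  have himage : Γ₂.coords c '' Γ₂.cell Γ₂.canonical c =
      L.toLinearMap.toAffineMap '' (Γ₁.coords c '' Γ₁.cell Γ₁.canonical c) := by
    rw [cell_eq_image hconn hstable hgenus Γ₁ Γ₂ c, image_image, image_image]
    refine image_congr fun D _ => ?_
    funext q
    rw [coords_rescaleDiv]
    rfl
  rw [cellDim, cellDim, himage, ← AffineMap.map_vectorSpan]
  exact (LinearEquiv.finrank_map_eq L _).symm

theorem isFace_of_isFace (hconn : G.Connected) (hstable : G.Stable) (hgenus : G.genus = 2)
    (Γ₁ Γ₂ : TropicalCurve G) {c c' : CellData V E} (h : Γ₁.IsFace Γ₁.canonical c c') :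
    Γ₂.IsFace Γ₂.canonical c c' := by
  let _ := Γ₁.divisorTopology
  let _ := Γ₂.divisorTopology
  have hcont : Continuous (Γ₁.rescaleDiv Γ₂) := continuous_rescaleDiv Γ₁ Γ₂
  have h' : Γ₁.cell Γ₁.canonical c ⊆ closure (Γ₁.cell Γ₁.canonical c') := h
  change Γ₂.cell Γ₂.canonical c ⊆ closure (Γ₂.cell Γ₂.canonical c')
  rw [cell_eq_image hconn hstable hgenus Γ₁ Γ₂ c, cell_eq_image hconn hstable hgenus Γ₁ Γ₂ c']
  exact (image_mono h').trans (image_closure_subset_closure_image hcont)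

/-- In genus two the canonical system does not depend on the edge lengths. -/
theorem sameCombinatorialStructure_canonical (hconn : G.Connected) (hstable : G.Stable)
    (hgenus : G.genus = 2) (Γ₁ Γ₂ : TropicalCurve G) :
    SameCombinatorialStructure Γ₁.canonical Γ₂.canonical :=
  ⟨(cells_subset hconn hstable hgenus Γ₁ Γ₂).antisymm (cells_subset hconn hstable hgenus Γ₂ Γ₁),
    fun c _ => cellDim_eq hconn hstable hgenus Γ₁ Γ₂ c,
    fun _ _ _ _ => ⟨isFace_of_isFace hconn hstable hgenus Γ₁ Γ₂,
      isFace_of_isFace hconn hstable hgenus Γ₂ Γ₁⟩⟩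

end TropicalCurve

namespace TropicalCurve

variable {V E : Type*} {G : WeightedGraph V E}

/-! ### Tent functions -/

/-- The function on `[0, l]` with slope `-1` on `[0, t]`, slope `0` on `[t, l - t]` and slope `1`
on `[l - t, l]`, for `0 ≤ t ≤ l / 2`. -/
def tent (l t x : ℝ) : ℝ := max (max (-x) (x - l)) (-t)

theorem tent_of_le {l t x : ℝ} (ht : t ≤ l / 2) (hx : x ≤ t) : tent l t x = -x := by
  rw [tent, max_eq_left (a := -x) (by linarith), max_eq_left (by linarith)]

theorem tent_of_mem_Icc {l t x : ℝ} (hx : x ∈ Icc t (l - t)) : tent l t x = -t :=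
  max_eq_right (max_le (by linarith [hx.1]) (by linarith [hx.2]))

theorem tent_of_ge {l t x : ℝ} (ht : t ≤ l / 2) (hx : l - t ≤ x) : tent l t x = x - l := by
  rw [tent, max_eq_right (a := -x) (by linarith), max_eq_left (by linarith)]

theorem continuous_tent (l t : ℝ) : Continuous (tent l t) := by
  unfold tent
  fun_prop

variable (Γ : TropicalCurve G)

open Classical in
/-- `f` is, up to a constant, the tent function with parameter `t` on the edge `e`, and zero on the
other edges. -/
def IsTent (f : Γ.Point → ℝ) (e : E) (t : ℝ) : Prop :=
  ∃ k : ℝ, ∀ e', ∀ x ∈ Icc 0 (Γ.length e'),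
    Γ.onEdge f e' x = k + if e' = e then tent (Γ.length e) t x else 0

/-- The divisor consisting of the points at distance `t` from the two ends of the edge `e`. -/
def pairDiv (e : E) (t : ℝ) : Γ.Divisor :=
  Finsupp.single (Γ.par e t) 1 + Finsupp.single (Γ.par e (Γ.length e - t)) 1

open Classical in
/-- The tent function with parameter `t` on the edge `e`, extended by zero. -/
def tentFun (e : E) (t : ℝ) : Γ.Point → ℝ
  | .vertex _ => 0
  | .interior e' x _ => if e' = e then tent (Γ.length e) t x else 0

variable {Γ}

theorem isTent_tentFun {e : E} {t : ℝ} (h0 : 0 ≤ t) (ht : t ≤ Γ.length e / 2) :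
    Γ.IsTent (Γ.tentFun e t) e t := by
  refine ⟨0, fun e' x hx => ?_⟩
  rw [zero_add, onEdge]
  rcases hx.1.eq_or_lt with rfl | h
  · rw [par_zero, tentFun, tent_of_le ht h0]
    simp
  rcases hx.2.eq_or_lt with rfl | h'
  · rw [par_length, tentFun]
    split_ifs with he
    · rw [he, tent_of_ge ht (by linarith), sub_self]
    · rfl
  · rw [par_of_mem Γ ⟨h, h'⟩, tentFun]

theorem IsTent.isRational {f : Γ.Point → ℝ} {e : E} {t : ℝ} (hf : Γ.IsTent f e t)
    (ht : t ≤ Γ.length e / 2) : Γ.IsRational f := by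
  obtain ⟨k, hk⟩ := hf
  refine ⟨Γ.continuous_iff_onEdge.2 fun e' => ?_, fun e' => ?_⟩
  · refine ContinuousOn.congr (Continuous.continuousOn ?_) (hk e')
    split_ifs
    · exact continuous_const.add (continuous_tent _ _)
    · exact continuous_const
  by_cases he : e' = e
  · subst he
    refine ⟨{t, Γ.length e' - t}, fun a b ha hab hb hs => ?_⟩
    have h1 := hs t (by simp)
    have h2 := hs (Γ.length e' - t) (by simp)
    rw [mem_Ioo, not_and_or, not_lt, not_lt] at h1 h2
    have hmem {x : ℝ} (hx : x ∈ Icc a b) : x ∈ Icc 0 (Γ.length e') :=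
      ⟨ha.trans hx.1, hx.2.trans hb⟩
    rcases h1 with h1 | h1
    · rcases h2 with h2 | h2
      · refine ⟨1, k - Γ.length e', fun x hx => ?_⟩
        rw [hk _ _ (hmem hx), if_pos rfl, tent_of_ge ht (h2.trans hx.1)]
        push_cast; ring
      · refine ⟨0, k - t, fun x hx => ?_⟩
        rw [hk _ _ (hmem hx), if_pos rfl, tent_of_mem_Icc ⟨h1.trans hx.1, hx.2.trans h2⟩]
        push_cast; ring
    · refine ⟨-1, k, fun x hx => ?_⟩
      rw [hk _ _ (hmem hx), if_pos rfl, tent_of_le ht (hx.2.trans h1)]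
      push_cast; ring
  · refine ⟨∅, fun a b ha hab hb _ => ⟨0, k, fun x hx => ?_⟩⟩
    rw [hk _ _ ⟨ha.trans hx.1, hx.2.trans hb⟩, if_neg he]
    simp

open Classical in
theorem IsTent.slopeRight {f : Γ.Point → ℝ} {e : E} {t : ℝ} (hf : Γ.IsTent f e t)
    (ht : t ≤ Γ.length e / 2) {e' : E} {x : ℝ} (h0 : 0 ≤ x) (hx : x < Γ.length e') :
    Γ.slopeRight f e' x =
      if e' = e then if x < t then -1 else if x < Γ.length e - t then 0 else 1 else 0 := by
  obtain ⟨k, hk⟩ := hf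
  refine slopeRight_eq (hasDerivWithinAt_of_eventually_affine ?_)
  split_ifs with he h1 h2
  · subst he
    filter_upwards [Ioo_mem_nhdsGT (lt_min hx h1)] with y hy
    have := hy.2.trans_le (min_le_left _ _)
    have := hy.2.trans_le (min_le_right _ _)
    rw [hk _ _ ⟨h0, hx.le⟩, hk _ _ ⟨h0.trans hy.1.le, by linarith⟩, if_pos rfl, if_pos rfl,
      tent_of_le ht h1.le, tent_of_le ht (by linarith)]
    ring
  · subst he
    filter_upwards [Ioo_mem_nhdsGT (lt_min hx h2)] with y hy
    have := hy.1
    have := hy.2.trans_le (min_le_left _ _)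
    have := hy.2.trans_le (min_le_right _ _)
    rw [hk _ _ ⟨h0, hx.le⟩, hk _ _ ⟨h0.trans hy.1.le, by linarith⟩, if_pos rfl, if_pos rfl,
      tent_of_mem_Icc ⟨by linarith, h2.le⟩, tent_of_mem_Icc ⟨by linarith, by linarith⟩]
    ring
  · subst he
    filter_upwards [Ioo_mem_nhdsGT hx] with y hy
    have := hy.1
    rw [hk _ _ ⟨h0, hx.le⟩, hk _ _ ⟨h0.trans hy.1.le, hy.2.le⟩, if_pos rfl, if_pos rfl,
      tent_of_ge ht (by linarith), tent_of_ge ht (by linarith)]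
    ring
  · filter_upwards [Ioo_mem_nhdsGT hx] with y hy
    rw [hk _ _ ⟨h0, hx.le⟩, hk _ _ ⟨h0.trans hy.1.le, hy.2.le⟩, if_neg he, if_neg he]
    ring

open Classical in
theorem IsTent.slopeLeft {f : Γ.Point → ℝ} {e : E} {t : ℝ} (hf : Γ.IsTent f e t)
    (ht : t ≤ Γ.length e / 2) {e' : E} {x : ℝ} (h0 : 0 < x) (hx : x ≤ Γ.length e') :
    Γ.slopeLeft f e' x =
      if e' = e then if x ≤ t then -1 else if x ≤ Γ.length e - t then 0 else 1 else 0 := by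
  obtain ⟨k, hk⟩ := hf
  refine slopeLeft_eq (hasDerivWithinAt_of_eventually_affine ?_)
  split_ifs with he h1 h2
  · subst he
    filter_upwards [Ioo_mem_nhdsLT h0] with y hy
    have := hy.2
    rw [hk _ _ ⟨h0.le, hx⟩, hk _ _ ⟨hy.1.le, by linarith⟩, if_pos rfl, if_pos rfl,
      tent_of_le ht h1, tent_of_le ht (by linarith)]
    ring
  · subst he
    filter_upwards [Ioo_mem_nhdsLT (max_lt h0 (not_le.1 h1))] with y hy
    have := hy.2
    have := (le_max_left _ _).trans_lt hy.1
    have := (le_max_right _ _).trans_lt hy.1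
    rw [hk _ _ ⟨h0.le, hx⟩, hk _ _ ⟨by linarith, by linarith⟩, if_pos rfl, if_pos rfl,
      tent_of_mem_Icc ⟨by linarith, h2⟩, tent_of_mem_Icc ⟨by linarith, by linarith⟩]
    ring
  · subst he
    filter_upwards [Ioo_mem_nhdsLT (max_lt h0 (not_le.1 h2))] with y hy
    have := hy.2
    have := (le_max_left _ _).trans_lt hy.1
    have := (le_max_right _ _).trans_lt hy.1
    rw [hk _ _ ⟨h0.le, hx⟩, hk _ _ ⟨by linarith, by linarith⟩, if_pos rfl, if_pos rfl,
      tent_of_ge ht (by linarith), tent_of_ge ht (by linarith)]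
    ring
  · filter_upwards [Ioo_mem_nhdsLT h0] with y hy
    have := hy.2
    rw [hk _ _ ⟨h0.le, hx⟩, hk _ _ ⟨hy.1.le, by linarith⟩, if_neg he, if_neg he]
    ring

/-! ### Pairs of points on an edge -/

theorem par_eq_interior {e e' : E} {t x : ℝ} {hx : 0 < x ∧ x < Γ.length e'} :
    Γ.par e t = .interior e' x hx ↔ e' = e ∧ x = t := by
  constructor
  · intro h
    rw [par] at h
    split_ifs at h
    rw [Point.interior.injEq] at h
    exact ⟨h.1.symm, h.2.symm⟩
  · rintro ⟨rfl, rfl⟩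
    exact par_of_mem Γ hx

open Classical in
theorem pairDiv_interior {e e' : E} {t x : ℝ} (hx : 0 < x ∧ x < Γ.length e') :
    Γ.pairDiv e t (.interior e' x hx) =
      (if e' = e ∧ x = t then 1 else 0) + if e' = e ∧ x = Γ.length e - t then 1 else 0 := by
  rw [pairDiv, Finsupp.add_apply, Finsupp.single_apply, Finsupp.single_apply]
  simp only [par_eq_interior]

theorem pairDiv_interior_ne_zero {e e' : E} {t x : ℝ} (hx : 0 < x ∧ x < Γ.length e') :
    Γ.pairDiv e t (.interior e' x hx) ≠ 0 ↔ e' = e ∧ (x = t ∨ x = Γ.length e - t) := by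
  classical
  rw [pairDiv_interior, and_or_left]
  split_ifs with h1 h2 h2 <;> simp [h1, h2]

theorem pairDiv_vertex_of_pos [DecidableEq V] {e : E} {t : ℝ} (h0 : 0 < t) (ht : t < Γ.length e)
    (v : V) : Γ.pairDiv e t (.vertex v) = 0 := by
  classical
  rw [pairDiv, par_of_mem Γ ⟨h0, ht⟩, par_of_mem Γ (x := Γ.length e - t) ⟨by linarith, by linarith⟩,
    Finsupp.add_apply, Finsupp.single_apply, Finsupp.single_apply]
  simp

theorem pairDiv_zero_vertex [DecidableEq V] (e : E) (v : V) : Γ.pairDiv e 0 (.vertex v) =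
    (if G.src e = v then 1 else 0) + if G.tgt e = v then 1 else 0 := by
  classical
  rw [pairDiv, sub_zero, par_zero, par_length, Finsupp.add_apply, Finsupp.single_apply,
    Finsupp.single_apply]
  simp

theorem pairDiv_nonneg (e : E) (t : ℝ) : 0 ≤ Γ.pairDiv e t :=
  add_nonneg (Finsupp.single_nonneg.2 zero_le_one) (Finsupp.single_nonneg.2 zero_le_one)

/-- The positions on `e` are the strictly increasing list of the points of the support. -/
theorem positions_eq {D : Γ.Divisor} {e : E} {L : List ℝ} (hL : L.Pairwise (· < ·))
    (h : ∀ x, x ∈ L ↔ ∃ hx : 0 < x ∧ x < Γ.length e, D (.interior e x hx) ≠ 0) :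
    Γ.positions D e = L := by
  have h1 : (Γ.finite_positions D e).toFinset = L.toFinset := by
    ext x
    rw [Finite.mem_toFinset, List.mem_toFinset, h, mem_ofPred_eq]
    constructor
    · rintro ⟨hx, hD⟩
      rw [par_of_mem Γ hx] at hD
      exact ⟨hx, hD⟩
    · rintro ⟨hx, hD⟩
      rw [par_of_mem Γ hx]
      exact ⟨hx, hD⟩
  rw [positions, h1]
  exact (List.toFinset_sort _ (hL.imp ne_of_lt)).2 (hL.imp le_of_lt)

open Classical in
theorem positions_pairDiv {e : E} {t : ℝ} (h0 : 0 ≤ t) (ht : t ≤ Γ.length e / 2) (e' : E) :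
    Γ.positions (Γ.pairDiv e t) e' = if e' = e ∧ 0 < t then
      if t < Γ.length e / 2 then [t, Γ.length e - t] else [t] else [] := by
  have hl := Γ.length_pos e
  apply positions_eq
  · split_ifs with h1 h2
    · simp; linarith
    · simp
    · simp
  · intro x
    simp only [pairDiv_interior_ne_zero]
    split_ifs with h1 h2
    · obtain ⟨rfl, h1⟩ := h1
      simp only [List.mem_cons, List.not_mem_nil, or_false, true_and]
      refine ⟨fun h => ⟨?_, h⟩, fun ⟨_, h⟩ => h⟩
      rcases h with rfl | rfl <;> constructor <;> linarith
    · obtain ⟨rfl, h1⟩ := h1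
      have h3 : Γ.length e' - t = t := by linarith
      simp only [h3, List.mem_cons, List.not_mem_nil, or_false, true_and, or_self]
      refine ⟨fun h => ⟨?_, h⟩, fun ⟨_, h⟩ => h⟩
      subst h
      constructor <;> linarith
    · simp only [List.not_mem_nil, false_iff]
      rintro ⟨hx, rfl, rfl | rfl⟩
      · exact h1 ⟨rfl, hx.1⟩
      · exact h1 ⟨rfl, by linarith [hx.2]⟩

/-- On a theta graph the canonical divisor plus the divisor of a tent function is a pair of
points. -/
theorem IsTent.isAddDiv_pairDiv [Fintype V] [Fintype E] [DecidableEq V]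
    (hends : ∀ (e : E) (v : V), (G.src e = v ∧ G.tgt e ≠ v) ∨ (G.src e ≠ v ∧ G.tgt e = v))
    (hK : ∀ v, Γ.canonical (.vertex v) = 1) {f : Γ.Point → ℝ} {e : E} {t : ℝ}
    (hf : Γ.IsTent f e t) (h0 : 0 ≤ t) (ht : t ≤ Γ.length e / 2) :
    Γ.IsAddDiv Γ.canonical f (Γ.pairDiv e t) := by
  classical
  have hl := Γ.length_pos e
  intro p
  cases p with
  | vertex v =>
    have hterm (e' : E) : outSlope f v e' = if e' = e then if 0 < t then -1 else 0 else 0 := by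
      have hl' := Γ.length_pos e'
      rw [outSlope, hf.slopeRight ht le_rfl hl', hf.slopeLeft ht hl' le_rfl]
      by_cases he : e' = e
      · subst he
        have h1 : ¬ Γ.length e' ≤ t := by linarith
        have h2 : 0 < Γ.length e' - t := by linarith
        have h3 : Γ.length e' ≤ Γ.length e' - t ↔ ¬ 0 < t := by
          rw [not_lt]; constructor <;> intro h <;> linarith
        simp only [if_true, h1, h2, h3, if_false]
        rcases hends e' v with ⟨ha, hb⟩ | ⟨ha, hb⟩
        · simp [ha, hb]
        · simp only [ha, hb, if_false, if_true]
          split_ifs <;> simp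
      · simp [he]
    rw [ord_vertex, hK, Finset.sum_congr rfl fun e' _ => hterm e', Finset.sum_ite_eq',
      if_pos (Finset.mem_univ e)]
    rcases h0.eq_or_lt with rfl | h
    · rw [pairDiv_zero_vertex]
      rcases hends e v with ⟨ha, hb⟩ | ⟨ha, hb⟩ <;> simp [ha, hb]
    · rw [pairDiv_vertex_of_pos h (by linarith), if_pos h]
      simp
  | interior e' x hx =>
    rw [canonical_interior, ord_interior, hf.slopeRight ht hx.1.le hx.2,
      hf.slopeLeft ht hx.1 hx.2.le, pairDiv_interior]
    by_cases he : e' = e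
    · subst he
      simp only [if_true, true_and]
      rcases lt_trichotomy x t with h | h | h
      · have h2 : x ≠ Γ.length e' - t := by intro h; linarith
        simp [h, h.le, h.ne, h2]
      · subst h
        have : Γ.length e' - x ≥ x := by linarith
        rcases this.eq_or_lt with h2 | h2
        · generalize Γ.length e' - x = y at h2 ⊢
          subst h2
          simp; norm_num
        · simp [h2, h2.ne]
      · rcases lt_trichotomy x (Γ.length e' - t) with h2 | h2 | h2
        · simp [h.ne', h.not_gt, h.not_ge, h2, h2.le, h2.ne]
        · have h3 : ¬ Γ.length e' - t ≤ t := by linarith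
          have h4 : ¬ Γ.length e' - t < t := by linarith
          simp [h2, h3, h4, (not_le.1 h3).ne']
        · simp [h.ne', h.not_gt, h.not_ge, h2.not_ge, h2.not_gt, h2.ne']
    · simp [he]

end TropicalCurve

/-! ### Theta graphs -/

namespace WeightedGraph

variable {V E : Type*} {G : WeightedGraph V E}

theorem IsTheta.ends (hG : G.IsTheta) (e : E) (v : V) :
    (G.src e = v ∧ G.tgt e ≠ v) ∨ (G.src e ≠ v ∧ G.tgt e = v) := by
  obtain ⟨hV, -, -, hne⟩ := hG
  obtain ⟨a, b, hab, huniv⟩ := Nat.card_eq_two_iff.1 hV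
  have h (u : V) : u = a ∨ u = b := by
    have := mem_univ u
    rwa [← huniv] at this
  grind [hne e, h (G.src e), h (G.tgt e), h v]

theorem IsTheta.valence_eq (hG : G.IsTheta) (v : V) : G.valence v = 3 := by
  classical
  have : Finite E := Nat.finite_of_card_ne_zero (by rw [hG.2.1]; norm_num)
  have h (e : E) : G.tgt e = v ↔ ¬ G.src e = v := by grind [hG.ends e v]
  rw [valence, Nat.card_congr (Equiv.subtypeEquivRight h), ← Nat.card_sum,
    Nat.card_congr (Equiv.sumCompl _), hG.2.1]

theorem IsTheta.exists_ne (hG : G.IsTheta) (e : E) : ∃ e', e' ≠ e := by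
  have : Finite E := Nat.finite_of_card_ne_zero (by rw [hG.2.1]; norm_num)
  have : Nontrivial E := Finite.one_lt_card_iff_nontrivial.1 (by rw [hG.2.1]; norm_num)
  exact _root_.exists_ne e

theorem IsTheta.nonempty (hG : G.IsTheta) : Nonempty E :=
  (Nat.card_ne_zero.1 (by rw [hG.2.1]; norm_num)).1

end WeightedGraph

namespace TropicalCurve

variable {V E : Type*} {G : WeightedGraph V E} {Γ : TropicalCurve G}

theorem canonical_vertex_of_isTheta [Fintype V] (hG : G.IsTheta) (v : V) :
    Γ.canonical (.vertex v) = 1 := by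
  rw [canonical_vertex, hG.valence_eq, hG.2.2.1]
  norm_num

variable [Fintype E] [DecidableEq V] [Fintype V]

/-- On a theta graph `f` takes the same value at the two vertices if `K + (f)` is effective. -/
theorem IsAddDiv.vertex_eq (hconn : G.Connected) (hstable : G.Stable)
    (hgenus : G.genus = 2) (hG : G.IsTheta) {f : Γ.Point → ℝ} (hf : Γ.IsRational f)
    {D : Γ.Divisor} (hD : Γ.IsAddDiv Γ.canonical f D) (h0 : 0 ≤ D) (u v : V) :
    f (.vertex u) = f (.vertex v) := by
  by_contra hne
  obtain ⟨e₁⟩ := hG.nonempty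
  obtain ⟨e₂, h21⟩ := hG.exists_ne e₁
  have huv : u ≠ v := fun h => hne (by rw [h])
  have h (e : E) : f (.vertex (G.src e)) ≠ f (.vertex (G.tgt e)) := by
    rcases hG.ends e u with ⟨h1, h2⟩ | ⟨h1, h2⟩ <;> rcases hG.ends e v with ⟨h3, h4⟩ | ⟨h3, h4⟩
    · exact absurd (h1.symm.trans h3) huv
    · rwa [h1, h4]
    · rw [h2, h3]; exact Ne.symm hne
    · exact absurd (h2.symm.trans h4) huv
  exact h21 (hD.edge_unique hconn hstable hgenus hf h0 (h e₂) (h e₁))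

/-- If `f` has equal values at the ends of `e` but is not constant on `e`, then it decreases
when moving away from either end. -/
theorem IsAddDiv.outSlope_le_neg_one_of_ne {f : Γ.Point → ℝ} (hf : Γ.IsRational f)
    {D : Γ.Divisor} (hD : Γ.IsAddDiv Γ.canonical f D) (h0 : 0 ≤ D) {k : ℝ}
    (hk : ∀ v, f (.vertex v) = k) {e : E} {x : ℝ} (hx : x ∈ Icc 0 (Γ.length e))
    (hne : Γ.onEdge f e x ≠ k) :
    Γ.slopeRight f e 0 ≤ -1 ∧ 1 ≤ Γ.slopeLeft f e (Γ.length e) := by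
  have hl := Γ.length_pos e
  have hle : Γ.onEdge f e x ≤ k := by
    have := (hD.convexOn hf h0 e).le_max_of_mem_Icc ⟨le_rfl, hl.le⟩ ⟨hl.le, le_rfl⟩ hx
    simpa [hk] using this
  have hlt := lt_of_le_of_ne hle hne
  have hx0 : 0 < x := lt_of_le_of_ne hx.1 (by rintro rfl; simp [hk] at hne)
  have hxl : x < Γ.length e := lt_of_le_of_ne hx.2 (by rintro rfl; simp [hk] at hne)
  have h1 := hD.slopeRight_mul_le hf h0 (e := e) le_rfl hx0 hx.2
  have h2 := hD.le_slopeLeft_mul hf h0 (e := e) hx.1 hxl le_rfl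
  simp only [onEdge_zero, onEdge_length, hk, sub_zero] at h1 h2
  obtain ⟨m, hm, -⟩ := hf.exists_slopeRight (e := e) le_rfl hl
  obtain ⟨n, hn, -⟩ := hf.exists_slopeLeft (e := e) hl le_rfl
  rw [hm] at h1 ⊢
  rw [hn] at h2 ⊢
  have h3 : (m : ℝ) < 0 := by
    by_contra! hc
    nlinarith [mul_nonneg hc hx0.le]
  have h4 : (0 : ℝ) < n := by
    by_contra! hc
    nlinarith [mul_nonneg (neg_nonneg.2 hc) (sub_pos.2 hxl).le]
  have h5 : m < 0 := by exact_mod_cast h3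
  have h6 : 0 < n := by exact_mod_cast h4
  exact ⟨by exact_mod_cast (by lia : m ≤ -1), by exact_mod_cast (by lia : 1 ≤ n)⟩

/-- A convex function on an edge with integer slopes, equal values at the ends, and outgoing slopes
at least `-1` is a tent function. -/
theorem IsAddDiv.exists_tent {f : Γ.Point → ℝ} (hf : Γ.IsRational f)
    {D : Γ.Divisor} (hD : Γ.IsAddDiv Γ.canonical f D) (h0 : 0 ≤ D) {k : ℝ}
    (hk : ∀ v, f (.vertex v) = k) {e : E} (hs : -1 ≤ Γ.slopeRight f e 0)
    (hs' : Γ.slopeLeft f e (Γ.length e) ≤ 1) : ∃ t, 0 ≤ t ∧ t ≤ Γ.length e / 2 ∧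
      ∀ x ∈ Icc 0 (Γ.length e), Γ.onEdge f e x = k + tent (Γ.length e) t x := by
  have hl := Γ.length_pos e
  have hlow {x : ℝ} (hx : x ∈ Icc 0 (Γ.length e)) : k - x ≤ Γ.onEdge f e x := by
    rcases hx.1.eq_or_lt with rfl | h
    · simp [hk]
    · have := hD.slopeRight_mul_le hf h0 (e := e) le_rfl h hx.2
      simp only [onEdge_zero, hk, sub_zero] at this
      nlinarith
  have hlow' {x : ℝ} (hx : x ∈ Icc 0 (Γ.length e)) :
      k + (x - Γ.length e) ≤ Γ.onEdge f e x := by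
    rcases hx.2.eq_or_lt with rfl | h
    · simp [hk]
    · have := hD.le_slopeLeft_mul hf h0 (e := e) hx.1 h le_rfl
      simp only [onEdge_length, hk] at this
      nlinarith
  obtain ⟨z, hz, hmin⟩ := isCompact_Icc.exists_isMinOn (nonempty_Icc.2 hl.le)
    (Γ.continuous_iff_onEdge.1 hf.1 e)
  have hz0 : Γ.onEdge f e z ≤ k := by
    simpa [hk] using hmin (show (0 : ℝ) ∈ Icc 0 (Γ.length e) from ⟨le_rfl, hl.le⟩)
  refine ⟨k - Γ.onEdge f e z, by linarith, by linarith [hlow hz, hlow' hz], fun x hx => ?_⟩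
  have hzx : Γ.onEdge f e z ≤ Γ.onEdge f e x := hmin hx
  refine le_antisymm ?_ ?_
  · rcases hx.1.eq_or_lt with rfl | hx0
    · simp [hk, tent]
    rcases hx.2.eq_or_lt with rfl | hxl
    · simp [hk, tent]
    by_contra! hc
    have hc1 : k - x < Γ.onEdge f e x := lt_of_le_of_lt (by
      have : -x ≤ tent (Γ.length e) (k - Γ.onEdge f e z) x :=
        (le_max_left _ _).trans (le_max_left _ _)
      linarith) hc
    have hc2 : k + (x - Γ.length e) < Γ.onEdge f e x := lt_of_le_of_lt (by
      have : x - Γ.length e ≤ tent (Γ.length e) (k - Γ.onEdge f e z) x :=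
        (le_max_right _ _).trans (le_max_left _ _)
      linarith) hc
    have hc3 : Γ.onEdge f e z < Γ.onEdge f e x := lt_of_le_of_lt (by
      have : -(k - Γ.onEdge f e z) ≤ tent (Γ.length e) (k - Γ.onEdge f e z) x :=
        le_max_right _ _
      linarith) hc
    obtain ⟨m, hm, -⟩ := hf.exists_slopeRight (e := e) hx.1 hxl
    obtain ⟨n, hn, -⟩ := hf.exists_slopeLeft (e := e) hx0 hx.2
    have hnm := hD.slopeLeft_le_slopeRight h0 (e := e) ⟨hx0, hxl⟩
    have h1 := hD.le_slopeLeft_mul hf h0 (e := e) le_rfl hx0 hx.2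
    have h2 := hD.slopeRight_mul_le hf h0 (e := e) hx.1 hxl le_rfl
    simp only [onEdge_zero, onEdge_length, hk, sub_zero] at h1 h2
    rw [hm, hn] at hnm
    rw [hn] at h1
    rw [hm] at h2
    have hnm' : n ≤ m := by exact_mod_cast hnm
    rcases lt_trichotomy x z with h | rfl | h
    · -- the slope is negative to the left of the minimum
      have h3 := hD.slopeRight_mul_le hf h0 (e := e) hx.1 h hz.2
      rw [hm] at h3
      have h4 : (m : ℝ) < 0 := by
        by_contra! hc
        nlinarith [mul_nonneg hc (sub_pos.2 h).le]
      have h5 : m < 0 := by exact_mod_cast h4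
      have h6 : (n : ℝ) ≤ -1 := by exact_mod_cast (by lia : n ≤ -1)
      nlinarith
    · exact lt_irrefl _ hc3
    · -- the slope is positive to the right of the minimum
      have h3 := hD.le_slopeLeft_mul hf h0 (e := e) hz.1 h hx.2
      rw [hn] at h3
      have h4 : (0 : ℝ) < n := by
        by_contra! hc
        nlinarith [mul_nonneg (neg_nonneg.2 hc) (sub_pos.2 h).le]
      have h5 : 0 < n := by exact_mod_cast h4
      have h6 : (1 : ℝ) ≤ m := by exact_mod_cast (by lia : 1 ≤ m)
      nlinarith
  · rw [← le_sub_iff_add_le']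
    refine max_le (max_le ?_ ?_) ?_
    · linarith [hlow hx]
    · linarith [hlow' hx]
    · linarith

/-- On a theta graph every rational function `f` with `K + (f)` effective is a tent function. -/
theorem IsAddDiv.exists_isTent (hconn : G.Connected) (hstable : G.Stable)
    (hgenus : G.genus = 2) (hG : G.IsTheta) {f : Γ.Point → ℝ} (hf : Γ.IsRational f)
    {D : Γ.Divisor} (hD : Γ.IsAddDiv Γ.canonical f D) (h0 : 0 ≤ D) :
    ∃ e t, 0 ≤ t ∧ t ≤ Γ.length e / 2 ∧ Γ.IsTent f e t := by
  classical
  obtain ⟨e₁⟩ := hG.nonempty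
  obtain ⟨k, hk⟩ : ∃ k, ∀ v, f (.vertex v) = k :=
    ⟨_, fun v => hD.vertex_eq hconn hstable hgenus hG hf h0 v (G.src e₁)⟩
  have hnonpos (v : V) (e : E) : outSlope f v e ≤ 0 :=
    hD.outSlope_nonpos hf h0 (fun u => by rw [hk, hk]) e
  have hsum (v : V) : -1 ≤ ∑ e, outSlope f v e := by
    have h1 := hD (.vertex v)
    rw [canonical_vertex_of_isTheta hG, ord_vertex] at h1
    have h2 : (0 : ℝ) ≤ D (.vertex v) := by exact_mod_cast h0 _
    push_cast at h1
    linarith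
  have hbound (s : Finset E) (v : V) : -1 ≤ ∑ e ∈ s, outSlope f v e := by
    refine (hsum v).trans ?_
    rw [← Finset.sum_add_sum_compl s]
    linarith [Finset.sum_nonpos (s := sᶜ) fun e _ => hnonpos v e]
  have hout (e : E) : outSlope f (G.src e) e = Γ.slopeRight f e 0 := by
    rw [outSlope, if_pos rfl, if_neg (hG.2.2.2 e).symm, add_zero]
  have hout' (e : E) : outSlope f (G.tgt e) e = -Γ.slopeLeft f e (Γ.length e) := by
    rw [outSlope, if_neg (hG.2.2.2 e), if_pos rfl, zero_add]
  by_cases hconst : ∀ e, ∀ x ∈ Icc 0 (Γ.length e), Γ.onEdge f e x = k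
  · refine ⟨e₁, 0, le_rfl, by linarith [Γ.length_pos e₁], k, fun e x hx => ?_⟩
    rw [hconst e x hx]
    split_ifs with he
    · subst he
      rw [tent_of_mem_Icc (by simpa using hx), neg_zero, add_zero]
    · rw [add_zero]
  push Not at hconst
  obtain ⟨e, x, hx, hne⟩ := hconst
  obtain ⟨t, ht0, ht, htent⟩ := hD.exists_tent hf h0 hk (e := e)
    (by simpa [hout] using hbound {e} (G.src e))
    (by have := hbound {e} (G.tgt e); simp [hout'] at this; exact this)
  refine ⟨e, t, ht0, ht, k, fun e' y hy => ?_⟩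
  by_cases he : e' = e
  · subst he
    rw [if_pos rfl, htent y hy]
  rw [if_neg he, add_zero]
  by_contra hne'
  -- two edges on which `f` is not constant would need two chips at a vertex
  have h1 := hD.outSlope_le_neg_one_of_ne hf h0 hk hx hne
  have h2 := hD.outSlope_le_neg_one_of_ne hf h0 hk hy hne'
  have h3 := hbound {e', e} (G.src e)
  rw [Finset.sum_pair he, hout] at h3
  rcases hG.ends e' (G.src e) with ⟨h4, -⟩ | ⟨-, h4⟩
  · rw [← h4, hout] at h3
    linarith
  · rw [← h4, hout'] at h3
    linarith

end TropicalCurve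

/-! ### Closures of families of divisors -/

namespace TropicalCurve

variable {V E : Type*} {G : WeightedGraph V E} {Γ : TropicalCurve G}

/-- The parametrization of an edge is continuous on all of `ℝ`, being constant outside of `[0, l(e)]`. -/
theorem continuous_par_real (e : E) : Continuous (Γ.par e) := by
  have hl := Γ.length_pos e
  refine ((Γ.continuous_par e).comp (continuous_projIcc (h := hl.le))).congr fun x => ?_
  rw [Function.comp_apply, coe_projIcc]
  rcases le_or_gt x 0 with h | h
  · rw [par_of_nonpos h, min_eq_right (by linarith), max_eq_left h, par_zero]
  · rcases le_or_gt (Γ.length e) x with h' | h'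
    · rw [par_of_length_le h', min_eq_left h', max_eq_right hl.le, par_length]
    · rw [min_eq_right h'.le, max_eq_right h.le]

theorem continuous_pairDiv (e : E) : @Continuous _ _ _ Γ.divisorTopology (Γ.pairDiv e) := by
  let _ := Γ.divisorTopology
  have h1 : Continuous (fun p : Fin 2 → Γ.Point => ∑ i, Finsupp.single (p i) (1 : ℤ)) :=
    continuous_iff_coinduced_le.2 (le_iSup (fun n : ℕ => TopologicalSpace.coinduced
      (fun p : Fin n → Γ.Point => ∑ i, Finsupp.single (p i) (1 : ℤ)) inferInstance) 2)
  have h2 : Continuous (fun t : ℝ => ![Γ.par e t, Γ.par e (Γ.length e - t)]) := by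
    refine continuous_pi fun i => ?_
    fin_cases i
    · exact continuous_par_real e
    · exact (continuous_par_real e).comp (continuous_const.sub continuous_id)
  refine (h1.comp h2).congr fun t => ?_
  simp [pairDiv]

theorem isOpen_interior_edge (e : E) :
    IsOpen {p : Γ.Point | ∃ x hx, p = .interior e x hx} := by
  refine isOpen_iSup_iff.2 fun e' => isOpen_coinduced.2 ?_
  by_cases he : e' = e
  · subst he
    have : (fun x : Icc (0 : ℝ) (Γ.length e') => Γ.par e' x) ⁻¹'
        {p : Γ.Point | ∃ x hx, p = .interior e' x hx} =
          (↑) ⁻¹' Ioo (0 : ℝ) (Γ.length e') := by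
      ext x
      simp only [mem_preimage, mem_ofPred_eq, par_eq_interior, true_and]
      exact ⟨fun ⟨y, hy, h⟩ => h ▸ hy, fun h => ⟨_, h, rfl⟩⟩
    rw [this]
    exact isOpen_Ioo.preimage continuous_subtype_val
  · convert isOpen_empty
    ext x
    simp only [mem_preimage, mem_ofPred_eq, par_eq_interior, mem_empty_iff_false, iff_false]
    rintro ⟨y, hy, h, -⟩
    exact he h.symm

/-- The divisors that have no positive coefficient in the interior of `e` form a closed set. -/
theorem isClosed_nonpos_on_edge (e : E) : @IsClosed _ Γ.divisorTopology
    {D : Γ.Divisor | ∀ x hx, D (.interior e x hx) ≤ 0} := by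
  classical
  refine isClosed_iSup_iff.2 fun n => isClosed_coinduced.2 ?_
  have : (fun p : Fin n → Γ.Point => ∑ i, Finsupp.single (p i) (1 : ℤ)) ⁻¹'
      {D : Γ.Divisor | ∀ x hx, D (.interior e x hx) ≤ 0} =
        ⋂ i, (fun p : Fin n → Γ.Point => p i) ⁻¹' {p | ∃ x hx, p = .interior e x hx}ᶜ := by
    ext p
    simp only [mem_preimage, mem_ofPred_eq, mem_iInter, mem_compl_iff, Finsupp.finsetSum_apply]
    constructor
    · rintro h i ⟨x, hx, hi⟩
      have h1 : (Finsupp.single (p i) (1 : ℤ)) (.interior e x hx) ≤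
          ∑ j, (Finsupp.single (p j) (1 : ℤ)) (.interior e x hx) :=
        Finset.single_le_sum (f := fun j => (Finsupp.single (p j) (1 : ℤ)) (.interior e x hx))
          (fun j _ => by rw [Finsupp.single_apply]; split_ifs <;> simp) (Finset.mem_univ i)
      rw [hi, Finsupp.single_eq_same, ← hi] at h1
      have h2 := h x hx
      rw [← hi] at h2
      linarith
    · intro h x hx
      refine (Finset.sum_eq_zero fun i _ => ?_).le
      rw [Finsupp.single_apply, if_neg]
      exact fun hi => h i ⟨x, hx, hi⟩
  rw [this]
  exact isClosed_iInter fun i =>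
    (isOpen_interior_edge e).isClosed_compl.preimage (continuous_apply i)

end TropicalCurve

/-! ### The cells of the canonical system of a theta graph -/

namespace CellData

variable (V : Type*) {E : Type*}

variable (E) in
/-- The data of the cell consisting of the canonical divisor of a theta graph. -/
def hub : CellData V E := ⟨fun _ => 1, fun _ => 0, fun _ => []⟩

open Classical in
/-- The data of a pair of distinct points in the interior of the edge `e`. -/
def seg (e : E) : CellData V E :=
  ⟨fun _ => 0, fun e' => if e' = e then -1 else 0, fun e' => if e' = e then [1, 1] else []⟩

open Classical in
/-- The data of twice the midpoint of the edge `e`. -/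
def mid (e : E) : CellData V E :=
  ⟨fun _ => 0, fun e' => if e' = e then -1 else 0, fun e' => if e' = e then [2] else []⟩

variable {V}

theorem seg_injective : Function.Injective (seg V : E → CellData V E) := by
  intro e e' h
  have := congrFun (congrArg slope h) e
  by_contra hne
  simp [seg, hne] at this

theorem mid_injective : Function.Injective (mid V : E → CellData V E) := by
  intro e e' h
  have := congrFun (congrArg slope h) e
  by_contra hne
  simp [mid, hne] at this

theorem seg_ne_hub (e : E) : seg V e ≠ hub V E := fun h => by
  simpa [seg, hub] using congrFun (congrArg slope h) e

theorem mid_ne_hub (e : E) : mid V e ≠ hub V E := fun h => by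
  simpa [mid, hub] using congrFun (congrArg slope h) e

theorem seg_ne_mid (e e' : E) : seg V e ≠ mid V e' := fun h => by
  have h1 := congrFun (congrArg mults h) e
  simp only [seg, mid, if_true] at h1
  split_ifs at h1
  simp at h1

end CellData

namespace TropicalCurve

open CellData

variable {V E : Type*} {G : WeightedGraph V E} {Γ : TropicalCurve G}

variable (Γ) in
/-- The discrete data of the divisor `pairDiv e t` on a theta graph. -/
def tentData (e : E) (t : ℝ) : CellData V E :=
  if t = 0 then hub V E else if t < Γ.length e / 2 then seg V e else mid V e

theorem tentData_eq_hub_iff {e : E} {t : ℝ} : Γ.tentData e t = hub V E ↔ t = 0 := by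
  rw [tentData]
  split_ifs with h1 h2 <;> simp [h1, seg_ne_hub, mid_ne_hub]

theorem tentData_eq_seg_iff {e e' : E} {t : ℝ} :
    Γ.tentData e t = seg V e' ↔ e = e' ∧ t ≠ 0 ∧ t < Γ.length e / 2 := by
  rw [tentData]
  split_ifs with h1 h2
  · simp [h1, (seg_ne_hub _).symm]
  · simp [h1, h2, seg_injective.eq_iff]
  · simp [h2, (seg_ne_mid _ _).symm]

theorem tentData_eq_mid_iff {e e' : E} {t : ℝ} :
    Γ.tentData e t = mid V e' ↔ e = e' ∧ t ≠ 0 ∧ Γ.length e / 2 ≤ t := by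
  rw [tentData]
  split_ifs with h1 h2
  · simp [h1, (mid_ne_hub _).symm]
  · simp [h2, seg_ne_mid]
  · simp [h1, not_lt.1 h2, mid_injective.eq_iff]

theorem tentData_vertexMult [DecidableEq V] (hG : G.IsTheta) {e : E} {t : ℝ} (h0 : 0 ≤ t)
    (ht : t ≤ Γ.length e / 2) (v : V) :
    Γ.pairDiv e t (.vertex v) = (Γ.tentData e t).vertexMult v := by
  have hl := Γ.length_pos e
  rcases h0.eq_or_lt with rfl | h
  · rw [pairDiv_zero_vertex, tentData, if_pos rfl, hub]
    rcases hG.ends e v with ⟨ha, hb⟩ | ⟨ha, hb⟩ <;> simp [ha, hb]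
  · rw [pairDiv_vertex_of_pos h (by linarith), tentData, if_neg h.ne']
    split_ifs <;> rfl

theorem IsTent.slopeRight_zero {f : Γ.Point → ℝ} {e : E} {t : ℝ} (hf : Γ.IsTent f e t)
    (h0 : 0 ≤ t) (ht : t ≤ Γ.length e / 2) (e' : E) :
    Γ.slopeRight f e' 0 = (Γ.tentData e t).slope e' := by
  have hl := Γ.length_pos e
  rw [hf.slopeRight ht le_rfl (Γ.length_pos e')]
  rcases h0.eq_or_lt with rfl | h
  · simp [tentData, hub, hl]
  · have : 0 < Γ.length e - t := by linarith
    rw [tentData, if_neg h.ne', if_pos h]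
    split_ifs <;> simp_all [seg, mid]

theorem map_positions_pairDiv {e : E} {t : ℝ} (h0 : 0 ≤ t) (ht : t ≤ Γ.length e / 2) (e' : E) :
    (Γ.positions (Γ.pairDiv e t) e').map (fun x => Γ.pairDiv e t (Γ.par e' x)) =
      (Γ.tentData e t).mults e' := by
  have hl := Γ.length_pos e
  rw [positions_pairDiv h0 ht]
  rcases h0.eq_or_lt with rfl | h
  · simp [tentData, hub]
  rw [tentData, if_neg h.ne']
  by_cases he : e' = e
  · subst he
    have h1 : Γ.pairDiv e' t (Γ.par e' t) = 1 + if t = Γ.length e' - t then 1 else 0 := by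
      rw [par_of_mem Γ ⟨h, by linarith⟩, pairDiv_interior]
      simp
    have h2 : Γ.pairDiv e' t (Γ.par e' (Γ.length e' - t)) =
        (if Γ.length e' - t = t then 1 else 0) + 1 := by
      rw [par_of_mem Γ (x := Γ.length e' - t) ⟨by linarith, by linarith⟩, pairDiv_interior]
      simp
    rw [if_pos ⟨rfl, h⟩]
    split_ifs with h4
    · have h5 : t ≠ Γ.length e' - t := by intro h; linarith
      simp [h1, h2, h5, h5.symm, seg]
    · have h5 : t = Γ.length e' - t := by linarith
      rw [if_pos h5] at h1
      simp [h1, mid]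
  · split_ifs <;> simp_all [seg, mid]

theorem pairDiv_zero [Fintype V] [DecidableEq V] (hG : G.IsTheta) (e : E) : Γ.pairDiv e 0 = Γ.canonical := by
  ext p
  cases p with
  | vertex v =>
    rw [canonical_vertex_of_isTheta hG, tentData_vertexMult hG le_rfl (by
      linarith [Γ.length_pos e]), tentData, if_pos rfl, hub]
  | interior e' x hx =>
    rw [canonical_interior]
    by_contra h
    rw [← ne_eq, pairDiv_interior_ne_zero] at h
    obtain ⟨rfl, rfl | rfl⟩ := h
    · exact lt_irrefl _ hx.1
    · linarith [hx.2]

theorem cellDim_of_singleton [Fintype E] [DecidableEq V] {D D' : Γ.Divisor} {c : CellData V E} (h : Γ.cell D c = {D'}) :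
    Γ.cellDim D c = 0 := by
  rw [cellDim, h, image_singleton, vectorSpan_singleton, finrank_bot]

variable [Fintype E] [Fintype V] [DecidableEq V]

/-- The cells of the canonical system of a theta graph: its elements are the divisors
`pairDiv e t`. -/
theorem mem_cell_iff (hconn : G.Connected) (hstable : G.Stable)
    (hgenus : G.genus = 2) (hG : G.IsTheta) {c : CellData V E} {D : Γ.Divisor} :
    D ∈ Γ.cell Γ.canonical c ↔
      ∃ e t, 0 ≤ t ∧ t ≤ Γ.length e / 2 ∧ D = Γ.pairDiv e t ∧ c = Γ.tentData e t := by
  constructor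
  · rintro ⟨h0, f, hf, hD, hv, hs, hm⟩
    obtain ⟨e, t, ht0, ht, hten⟩ := hD.exists_isTent hconn hstable hgenus hG hf h0
    have hDt : D = Γ.pairDiv e t := by
      ext p
      have := (hD p).trans
        (hten.isAddDiv_pairDiv hG.ends (canonical_vertex_of_isTheta hG) ht0 ht p).symm
      exact_mod_cast this
    subst hDt
    refine ⟨e, t, ht0, ht, rfl, ?_⟩
    ext1
    · funext v
      rw [← hv, tentData_vertexMult hG ht0 ht]
    · funext e'
      have := (hs e').symm.trans (hten.slopeRight_zero ht0 ht e')
      exact_mod_cast this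
    · funext e'
      rw [← hm, map_positions_pairDiv ht0 ht]
  · rintro ⟨e, t, ht0, ht, rfl, rfl⟩
    have hten := isTent_tentFun ht0 ht
    exact ⟨pairDiv_nonneg e t, Γ.tentFun e t, hten.isRational ht,
      hten.isAddDiv_pairDiv hG.ends (canonical_vertex_of_isTheta hG) ht0 ht,
      tentData_vertexMult hG ht0 ht, hten.slopeRight_zero ht0 ht, map_positions_pairDiv ht0 ht⟩

theorem cell_hub (hconn : G.Connected) (hstable : G.Stable)
    (hgenus : G.genus = 2) (hG : G.IsTheta) :
    Γ.cell Γ.canonical (hub V E) = {Γ.canonical} := by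
  ext D
  rw [mem_cell_iff hconn hstable hgenus hG, mem_singleton_iff]
  constructor
  · rintro ⟨e, t, -, -, rfl, h⟩
    rw [tentData_eq_hub_iff.1 h.symm, pairDiv_zero hG]
  · rintro rfl
    obtain ⟨e⟩ := hG.nonempty
    exact ⟨e, 0, le_rfl, by linarith [Γ.length_pos e], (pairDiv_zero hG e).symm,
      (tentData_eq_hub_iff.2 rfl).symm⟩

theorem cell_seg (hconn : G.Connected) (hstable : G.Stable)
    (hgenus : G.genus = 2) (hG : G.IsTheta) (e : E) :
    Γ.cell Γ.canonical (seg V e) = Γ.pairDiv e '' Ioo 0 (Γ.length e / 2) := by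
  ext D
  rw [mem_cell_iff hconn hstable hgenus hG]
  constructor
  · rintro ⟨e', t, h0, -, rfl, h⟩
    obtain ⟨rfl, h1, h2⟩ := tentData_eq_seg_iff.1 h.symm
    exact ⟨t, ⟨lt_of_le_of_ne h0 h1.symm, h2⟩, rfl⟩
  · rintro ⟨t, ht, rfl⟩
    exact ⟨e, t, ht.1.le, ht.2.le, rfl, (tentData_eq_seg_iff.2 ⟨rfl, ht.1.ne', ht.2⟩).symm⟩

theorem cell_mid (hconn : G.Connected) (hstable : G.Stable)
    (hgenus : G.genus = 2) (hG : G.IsTheta) (e : E) :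
    Γ.cell Γ.canonical (mid V e) = {Γ.pairDiv e (Γ.length e / 2)} := by
  ext D
  rw [mem_cell_iff hconn hstable hgenus hG, mem_singleton_iff]
  have hl := Γ.length_pos e
  constructor
  · rintro ⟨e', t, -, h0, rfl, h⟩
    obtain ⟨rfl, -, h2⟩ := tentData_eq_mid_iff.1 h.symm
    rw [le_antisymm h0 h2]
  · rintro rfl
    exact ⟨e, _, by positivity, le_rfl, rfl,
      (tentData_eq_mid_iff.2 ⟨rfl, by positivity, le_rfl⟩).symm⟩

theorem mem_cells_iff (hconn : G.Connected) (hstable : G.Stable)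
    (hgenus : G.genus = 2) (hG : G.IsTheta) {c : CellData V E} :
    c ∈ Γ.cells Γ.canonical ↔ c = hub V E ∨ (∃ e, mid V e = c) ∨ ∃ e, seg V e = c := by
  constructor
  · rintro ⟨D, hD⟩
    obtain ⟨e, t, -, -, -, rfl⟩ := (mem_cell_iff hconn hstable hgenus hG).1 hD
    rw [tentData]
    split_ifs
    · exact Or.inl rfl
    · exact Or.inr (Or.inr ⟨e, rfl⟩)
    · exact Or.inr (Or.inl ⟨e, rfl⟩)
  · rintro (rfl | ⟨e, rfl⟩ | ⟨e, rfl⟩)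
    · rw [cells, mem_ofPred_eq, cell_hub hconn hstable hgenus hG]
      exact singleton_nonempty _
    · rw [cells, mem_ofPred_eq, cell_mid hconn hstable hgenus hG]
      exact singleton_nonempty _
    · rw [cells, mem_ofPred_eq, cell_seg hconn hstable hgenus hG]
      exact (nonempty_Ioo.2 (half_pos (Γ.length_pos e))).image _

theorem cellDim_seg (hconn : G.Connected) (hstable : G.Stable)
    (hgenus : G.genus = 2) (hG : G.IsTheta) (e : E) :
    Γ.cellDim Γ.canonical (seg V e) = 1 := by
  classical
  have hl := Γ.length_pos e
  have hcoords {t : ℝ} (ht : t ∈ Ioo 0 (Γ.length e / 2))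
      (q : Σ e' : E, Fin ((seg V e).mults e').length) :
      Γ.coords (seg V e) (Γ.pairDiv e t) q =
        (if q.1 = e then [t, Γ.length e - t] else []).getD q.2 0 := by
    rw [coords, positions_pairDiv ht.1.le ht.2.le, if_pos ht.2]
    simp only [ht.1, and_true]
  rw [cellDim, cell_seg hconn hstable hgenus hG, image_image]
  apply le_antisymm
  · rw [← collinear_iff_finrank_le_one, collinear_iff_exists_forall_eq_smul_vadd]
    refine ⟨fun q => (if q.1 = e then [0, Γ.length e] else []).getD q.2 0,
      fun q => (if q.1 = e then [1, -1] else []).getD q.2 0, ?_⟩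
    rintro _ ⟨t, ht, rfl⟩
    refine ⟨t, funext fun q => (hcoords ht q).trans ?_⟩
    simp only [vadd_eq_add, Pi.add_apply, Pi.smul_apply, smul_eq_mul]
    split_ifs
    · rcases q.2.val with _ | _ | i
      · simp
      · simp; ring
      · simp
    · simp
  · -- two points of the cell with different coordinates
    rw [Nat.one_le_iff_ne_zero, Ne, Submodule.finrank_eq_zero, vectorSpan_eq_bot_iff_subsingleton]
    intro hsub
    have h1 : Γ.length e / 4 ∈ Ioo 0 (Γ.length e / 2) := ⟨by linarith, by linarith⟩
    have h2 : Γ.length e / 8 ∈ Ioo 0 (Γ.length e / 2) := ⟨by linarith, by linarith⟩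
    have h3 := congrFun (hsub (mem_image_of_mem _ h1) (mem_image_of_mem _ h2))
      ⟨e, ⟨0, by simp [seg]⟩⟩
    simp only [hcoords h1, hcoords h2, if_true] at h3
    simp at h3
    linarith

/-! ### Faces -/

theorem pairDiv_mem_closure_cell_seg (hconn : G.Connected) (hstable : G.Stable)
    (hgenus : G.genus = 2) (hG : G.IsTheta) {e : E} {t : ℝ}
    (ht : t ∈ Icc 0 (Γ.length e / 2)) :
    Γ.pairDiv e t ∈ closure[Γ.divisorTopology] (Γ.cell Γ.canonical (seg V e)) := by
  let _ := Γ.divisorTopology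
  rw [cell_seg hconn hstable hgenus hG]
  refine image_closure_subset_closure_image (continuous_pairDiv e) (mem_image_of_mem _ ?_)
  rwa [closure_Ioo (half_pos (Γ.length_pos e)).ne]

theorem cellsOfDim_zero (hconn : G.Connected) (hstable : G.Stable)
    (hgenus : G.genus = 2) (hG : G.IsTheta) :
    Γ.cellsOfDim Γ.canonical 0 = insert (hub V E) (range (mid V)) := by
  ext c
  rw [cellsOfDim, mem_ofPred_eq, mem_cells_iff hconn hstable hgenus hG, mem_insert_iff, mem_range]
  constructor
  · rintro ⟨rfl | h | ⟨e, rfl⟩, h0⟩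
    · exact Or.inl rfl
    · exact Or.inr h
    · rw [cellDim_seg hconn hstable hgenus hG] at h0
      exact absurd h0 one_ne_zero
  · rintro (rfl | ⟨e, rfl⟩)
    · exact ⟨Or.inl rfl, cellDim_of_singleton (cell_hub hconn hstable hgenus hG)⟩
    · exact ⟨Or.inr (Or.inl ⟨e, rfl⟩), cellDim_of_singleton (cell_mid hconn hstable hgenus hG e)⟩

theorem cellsOfDim_one (hconn : G.Connected) (hstable : G.Stable)
    (hgenus : G.genus = 2) (hG : G.IsTheta) :
    Γ.cellsOfDim Γ.canonical 1 = range (seg V) := by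
  ext c
  rw [cellsOfDim, mem_ofPred_eq, mem_cells_iff hconn hstable hgenus hG, mem_range]
  constructor
  · rintro ⟨rfl | ⟨e, rfl⟩ | h, h0⟩
    · rw [cellDim_of_singleton (cell_hub hconn hstable hgenus hG)] at h0
      exact absurd h0 zero_ne_one
    · rw [cellDim_of_singleton (cell_mid hconn hstable hgenus hG e)] at h0
      exact absurd h0 zero_ne_one
    · exact h
  · rintro ⟨e, rfl⟩
    exact ⟨Or.inr (Or.inr ⟨e, rfl⟩), cellDim_seg hconn hstable hgenus hG e⟩

/-- The segment of `e` joins the canonical divisor to twice the midpoint of `e`. -/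
theorem verticesOf_seg (hconn : G.Connected) (hstable : G.Stable)
    (hgenus : G.genus = 2) (hG : G.IsTheta) (e : E) :
    Γ.verticesOf Γ.canonical (seg V e) = {hub V E, mid V e} := by
  have hl := Γ.length_pos e
  ext c
  rw [verticesOf, mem_ofPred_eq, cellsOfDim_zero hconn hstable hgenus hG, mem_insert_iff,
    mem_insert_iff, mem_singleton_iff]
  constructor
  · rintro ⟨rfl | ⟨e', rfl⟩, hface⟩
    · exact Or.inl rfl
    · right
      by_contra hne
      have he : e' ≠ e := fun h => hne (by rw [h])
      let _ := Γ.divisorTopology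
      rw [IsFace, cell_mid hconn hstable hgenus hG, singleton_subset_iff] at hface
      have hl' := Γ.length_pos e'
      -- the edge `e'` contains no point of a divisor in the cell of `e`
      have hsub : Γ.cell Γ.canonical (seg V e) ⊆
          {D : Γ.Divisor | ∀ x hx, D (.interior e' x hx) ≤ 0} := by
        rw [cell_seg hconn hstable hgenus hG]
        rintro _ ⟨t, -, rfl⟩ x hx
        rw [pairDiv_interior, if_neg (fun h => he h.1), if_neg (fun h => he h.1), add_zero]
      have h1 := closure_minimal hsub (isClosed_nonpos_on_edge e') hface
        (Γ.length e' / 2) ⟨by linarith, by linarith⟩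
      rw [pairDiv_interior, if_pos ⟨rfl, rfl⟩] at h1
      split_ifs at h1 <;> norm_num at h1
  · rintro (rfl | rfl)
    · refine ⟨Or.inl rfl, ?_⟩
      rw [IsFace, cell_hub hconn hstable hgenus hG, singleton_subset_iff]
      have h := pairDiv_mem_closure_cell_seg hconn hstable hgenus hG (Γ := Γ) (e := e)
        ⟨le_rfl, (half_pos hl).le⟩
      rwa [pairDiv_zero hG] at h
    · refine ⟨Or.inr ⟨e, rfl⟩, ?_⟩
      rw [IsFace, cell_mid hconn hstable hgenus hG, singleton_subset_iff]
      exact pairDiv_mem_closure_cell_seg hconn hstable hgenus hG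
        ⟨(half_pos hl).le, le_rfl⟩

end TropicalCurve

end

open TropicalCurve CellData

theorem mainTheorem4 {V E : Type*} [Fintype V] [Fintype E] [DecidableEq V]
    (G : WeightedGraph V E) (hconn : G.Connected) (hstable : G.Stable) (hgenus : G.genus = 2) :
    (∀ Γ₁ Γ₂ : TropicalCurve G,
      TropicalCurve.SameCombinatorialStructure Γ₁.canonical Γ₂.canonical) ∧
    (G.IsTheta → ∀ Γ : TropicalCurve G,
      (∀ c ∈ Γ.cells Γ.canonical, Γ.cellDim Γ.canonical c ≤ 1) ∧
      (Γ.cellsOfDim Γ.canonical 0).ncard = 4 ∧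
      (Γ.cellsOfDim Γ.canonical 1).ncard = 3 ∧
      (∀ s ∈ Γ.cellsOfDim Γ.canonical 1, (Γ.verticesOf Γ.canonical s).ncard = 2) ∧
      ∃ o ∈ Γ.cellsOfDim Γ.canonical 0, Γ.cell Γ.canonical o = {Γ.canonical} ∧
        ∀ s ∈ Γ.cellsOfDim Γ.canonical 1, ∀ s' ∈ Γ.cellsOfDim Γ.canonical 1, s ≠ s' →
          Γ.verticesOf Γ.canonical s ∩ Γ.verticesOf Γ.canonical s' = {o}) := by
  refine ⟨sameCombinatorialStructure_canonical hconn hstable hgenus, fun hG Γ => ?_⟩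
  have hcard (g : E → CellData V E) (hg : g.Injective) : (range g).ncard = 3 := by
    rw [← image_univ, ncard_image_of_injective _ hg, ncard_univ, hG.2.1]
  rw [cellsOfDim_zero hconn hstable hgenus hG, cellsOfDim_one hconn hstable hgenus hG]
  refine ⟨fun c hc => ?_, ?_, hcard _ seg_injective, ?_, hub V E,
    mem_insert _ _, cell_hub hconn hstable hgenus hG, ?_⟩
  · obtain rfl | ⟨e, rfl⟩ | ⟨e, rfl⟩ := (mem_cells_iff hconn hstable hgenus hG).1 hc
    · rw [cellDim_of_singleton (cell_hub hconn hstable hgenus hG)]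
      exact zero_le_one
    · rw [cellDim_of_singleton (cell_mid hconn hstable hgenus hG e)]
      exact zero_le_one
    · rw [cellDim_seg hconn hstable hgenus hG]
  · rw [ncard_insert_of_notMem, hcard _ mid_injective]
    rintro ⟨e, he⟩
    exact mid_ne_hub e he
  · rintro _ ⟨e, rfl⟩
    rw [verticesOf_seg hconn hstable hgenus hG, ncard_pair (mid_ne_hub e).symm]
  · rintro _ ⟨e, rfl⟩ _ ⟨e', rfl⟩ hne
    rw [verticesOf_seg hconn hstable hgenus hG, verticesOf_seg hconn hstable hgenus hG]
    ext c
    simp only [mem_inter_iff, mem_insert_iff, mem_singleton_iff]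
    constructor
    · rintro ⟨rfl | rfl, h | h⟩
      · rfl
      · rfl
      · exact h
      · exact absurd (congrArg (seg V) (mid_injective h)) hne
    · rintro rfl
      exact ⟨Or.inl rfl, Or.inl rfl⟩
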